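/- **Setting.** Let $\Gamma$ be a metric graph, i.e. the metric realization of a finite connected graph with positive edge lengths. For $x\in\Gamma$ let $T_x(\Gamma)$ be the finite set of outgoing unit tangent directions at $x$. $\mathrm{Rat}(\Gamma)$ is the set of continuous piecewise affine functions $f:\Gamma\to\mathbb R$ with integral slopes; $\mathrm{slope}_\nu(f)$ is the outgoing slope of $f$ along $\nu\in T_x(\Gamma)$, $\delta_x(f)=(\mathrm{slope}_\nu(f))_{\nu\in T_x(\Gamma)}$, and $\mathrm{div}(f)=\sum_x \mathrm{ord}_x(f)\,x$ with $\mathrm{ord}_x(f)=-\sum_{\nu\in T_x(\Gamma)}\mathrm{slope}_\nu(f)$. A divisor is a finite formal $\mathbb Z$-linear combination of points of $\Gamma$; it is effective ($\geq 0$) if all its coefficients are non-negative. For a divisor $D$, $\mathrm{Rat}(D)=\{f\in\mathrm{Rat}(\Gamma): D+\mathrm{div}(f)\ge 0\}$. **Rank functions.** Let $r\ge 0$ be an integer, $[r]=\{0,\dots,r\}$, and let $\delta$ be the number of coordinates of the hypercube $[r]^\delta$, with its coordinatewise order and lattice operations $\vee,\wedge$; let $e_i$ be the $i$-th unit vector.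 A rank function is a map $\rho:[r]^\delta\to\{-1,0,\dots,r\}$ that is non-increasing, supermodular ($\rho(a)+\rho(b)\le\rho(a\vee b)+\rho(a\wedge b)$), and satisfies $\rho(t e_i)=r-t$ for all $i$ and all $t\in[r]$. It is standard if $\rho(a)=r-\sum_i a_i$ when $\sum_i a_i\le r$ and $\rho(a)=-1$ otherwise. A jump of $\rho$ is a point $a$ with $\rho(a)\ge 0$ and $\rho(a+e_i)=\rho(a)-1$ for every $i$ with $a+e_i\in[r]^\delta$. **Slope structures.** A slope structure $\mathfrak S$ of order $r$ on a simple graph model $G$ of $\Gamma$ consists of integers $s^{e}_0<\dots<s^{e}_r$ for each oriented edge $e$ of $G$, with $s^{uv}_i+s^{vu}_{r-i}=0$ for all $i$ and every edge $\{u,v\}$, and of a rank function $\rho_v$ on $[r]^{\mathbb E_v}$ for each vertex $v$, where $\mathbb E_v$ is the set of oriented edges with tail $v$. It is extended to $\Gamma$ by setting $s^\nu_i=s^{e}_i$ for every $x\in\Gamma$ and $\nu\in T_x(\Gamma)$, where $e$ is the oriented edge of $G$ parallel to $\nu$, and by letting $\rho_x$ be the standard rank function on $[r]^{T_x(\Gamma)}$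 for $x$ in the interior of an edge of $G$. A slope structure of order $r$ on $\Gamma$ is a collection of slopes $s^\nu_i$ and rank functions $\rho_x$ ($x\in\Gamma$, $\nu\in T_x(\Gamma)$) arising in this way from some model. Put $S^\nu=\{s^\nu_0,\dots,s^\nu_r\}$; for $a\in[r]^{T_x(\Gamma)}$ put $s_a=(s^\nu_{a_\nu})_{\nu}$; and let $S^x$ be the set of the vectors $s_a$ for $a$ a jump of $\rho_x$. $\mathrm{Rat}(D,\mathfrak S)$ is the set of $f\in\mathrm{Rat}(D)$ such that $\mathrm{slope}_\nu(f)\in S^\nu$ for all $x\in\Gamma$ and $\nu\in T_x(\Gamma)$, and $\delta_x(f)\in S^x$ for all $x$. For such $f$, write $\rho_x(\delta_x(f))=\rho_x(a)$ where $\delta_x(f)=s_a$. **Linear series.** A subset $M\subseteq\mathrm{Rat}(D,\mathfrak S)$ has the rank property if for every effective divisor $E$ of degree $r$ there is $f\in M$ with $\rho_x(\delta_x(f))\ge E(x)$ for all $x\in\Gamma$ and $D+\mathrm{div}(f)-E\ge 0$. The pair $(D,\mathfrak S)$ is a crude linear series if $\mathrm{Rat}(D,\mathfrak S)$ has the rank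 property. A linear series associated to the crude linear series $(D,\mathfrak S)$ is a subset $M\subseteq\mathrm{Rat}(D,\mathfrak S)$ that is stable under $(f,g)\mapsto\min(f,g)$ and under adding real constants, closed in $(\mathrm{Rat}(D),\|\cdot\|_\infty)$, and has the rank property. **Theorem.** Let $D$ be a divisor on $\Gamma$, let $\mathfrak S$ be a slope structure of order $r$ on $\Gamma$, and let $M$ be a linear series associated to $(D,\mathfrak S)$. 1. For every $v\in\Gamma$ and every jump $a$ of $\rho_v$, there is $f\in M$ with $\delta_v(f)=s_a$. 2. $M$ determines $\mathfrak S$: if $M$ is also a linear series associated to a pair $(D',\mathfrak S')$, where $D'$ is a divisor and $\mathfrak S'$ is a slope structure on $\Gamma$ of some order $r'$ (possibly coming from another graph model), then $S'^\nu=S^\nu$ and $S'^x=S^x$ for all $x\in\Gamma$ and $\nu\in T_x(\Gamma)$. If moreover $\Gamma$ is not a single point, then $r'=r$ and $\mathfrak S'=\mathfrak S$; that is, all slopes $s^\nu_i$ and all rank functions $\rho_x$ coincide. -/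

import Mathlib

open Set Filter Topology

universe u

/-! ## Rank functions on hypercubes

The hypercube of width `r` whose coordinates are indexed by a finite type `ι` is
`ι → Fin (r + 1)`, with its coordinatewise order and lattice operations. -/

/-- Rank functions on the hypercube `[r]^ι`. -/
structure IsRankFunction {ι : Type*} {r : ℕ} (ρ : (ι → Fin (r + 1)) → ℤ) : Prop where
  supermodular : ∀ a b, ρ a + ρ b ≤ ρ (a ⊔ b) + ρ (a ⊓ b)
  neg_one_le : ∀ a, -1 ≤ ρ a
  le_width : ∀ a, ρ a ≤ r
  antitone : ∀ a b, a ≤ b → ρ b ≤ ρ a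
  /-- `ρ (t • e_i) = r - t`. -/
  axis : ∀ (i : ι) (a : ι → Fin (r + 1)), (∀ j, j ≠ i → a j = 0) → ρ a = r - (a i : ℕ)

/-- Jumps of a rank function; `b` runs over the points `a + e_i` that lie in the hypercube. -/
def IsJump {ι : Type*} {r : ℕ} (ρ : (ι → Fin (r + 1)) → ℤ) (a : ι → Fin (r + 1)) : Prop :=
  0 ≤ ρ a ∧
    ∀ (i : ι) (b : ι → Fin (r + 1)),
      (b i : ℕ) = a i + 1 → (∀ j, j ≠ i → b j = a j) → ρ b = ρ a - 1

/-- The standard rank function. -/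
def standardRank {ι : Type*} [Fintype ι] {r : ℕ} (a : ι → Fin (r + 1)) : ℤ :=
  if ∑ i, (a i : ℕ) ≤ r then (r : ℤ) - ∑ i, ((a i : ℕ) : ℤ) else -1

/-! ## Metric graphs -/

/-- A metric graph, given by a model: a finite connected graph (loops and multiple edges are
allowed) with positive edge lengths. -/
structure MetricGraph : Type (u + 1) where
  V : Type u
  E : Type u
  finite_V : Finite V
  finite_E : Finite E
  src : E → V
  tgt : E → V
  len : E → ℝ
  len_pos : ∀ e, 0 < len e
  nonempty : Nonempty V
  connected : ∀ v w : V, Relation.EqvGen (fun a b => ∃ e, src e = a ∧ tgt e = b) v w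

namespace MetricGraph

/-- The points of the metric realization: vertices, and interior points of edges. -/
inductive Point (Γ : MetricGraph.{u}) : Type u
  | vertex (v : Γ.V) : Point Γ
  | inner (e : Γ.E) (t : ℝ) (ht : 0 < t ∧ t < Γ.len e) : Point Γ

variable (Γ : MetricGraph.{u})

/-- The point of the edge `e` at distance `t` from its source, for `0 ≤ t ≤ len e`
(real numbers outside this range are sent to the nearest extremity). -/
noncomputable def edgePoint (e : Γ.E) (t : ℝ) : Γ.Point :=
  if ht : 0 < t ∧ t < Γ.len e then Point.inner e t ht
  else if t ≤ 0 then Point.vertex (Γ.src e) else Point.vertex (Γ.tgt e)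

/-- The quotient topology of the disjoint union of the intervals `[0, len e]`. -/
noncomputable instance instTopologicalSpacePoint : TopologicalSpace Γ.Point :=
  ⨆ e : Γ.E, TopologicalSpace.coinduced
    (fun t : Set.Icc (0 : ℝ) (Γ.len e) => Γ.edgePoint e (t : ℝ)) inferInstance

/-- Oriented edges; `(e, false)` goes from the source of `e` to its target. -/
abbrev OEdge : Type u := Γ.E × Bool

/-- The same edge with the reverse orientation. -/
def rev {Γ : MetricGraph.{u}} (d : Γ.OEdge) : Γ.OEdge := (d.1, !d.2)

/-- The point of the oriented edge `d` at distance `t` from its tail. -/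
noncomputable def point (d : Γ.OEdge) (t : ℝ) : Γ.Point :=
  if d.2 then Γ.edgePoint d.1 (Γ.len d.1 - t) else Γ.edgePoint d.1 t

/-- The outgoing unit tangent directions at the point `x`: an oriented edge `edge`, followed
from the position `pos` of `x` on it (`x` is not the head of `edge`, in the sense that
`pos < len`). A vertex has one such direction for each oriented edge starting there (two for
each loop), and an interior point of an edge has two of them. -/
@[ext]
structure Tangent (x : Γ.Point) where
  edge : Γ.OEdge
  pos : ℝ
  pos_nonneg : 0 ≤ pos
  pos_lt : pos < Γ.len edge.1
  point_eq : Γ.point edge pos = x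

variable {Γ}

theorem edgePoint_inj_left {e : Γ.E} {s t : ℝ} (hs : 0 ≤ s) (hs' : s < Γ.len e) (ht : 0 ≤ t)
    (ht' : t < Γ.len e) (h : Γ.edgePoint e s = Γ.edgePoint e t) : s = t := by
  unfold edgePoint at h
  split_ifs at h <;> first | (cases h; rfl) | (cases h; done) | grind

theorem edgePoint_inj_right {e : Γ.E} {s t : ℝ} (hs : 0 < s) (hs' : s ≤ Γ.len e) (ht : 0 < t)
    (ht' : t ≤ Γ.len e) (h : Γ.edgePoint e s = Γ.edgePoint e t) : s = t := by
  unfold edgePoint at h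
  split_ifs at h <;> first | (cases h; rfl) | (cases h; done) | grind

theorem point_inj {d : Γ.OEdge} {s t : ℝ} (hs : 0 ≤ s) (hs' : s < Γ.len d.1) (ht : 0 ≤ t)
    (ht' : t < Γ.len d.1) (h : Γ.point d s = Γ.point d t) : s = t := by
  unfold point at h
  split_ifs at h
  · have := edgePoint_inj_right (by linarith) (by linarith) (by linarith) (by linarith) h
    linarith
  · exact edgePoint_inj_left hs hs' ht ht' h

theorem Tangent.edge_injective (x : Γ.Point) :
    Function.Injective (fun ν : Γ.Tangent x => ν.edge) := by
  rintro ⟨d, s, hs, hs', h⟩ ⟨d', t, ht, ht', h'⟩ hd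
  simp only at hd
  subst hd
  have := point_inj hs hs' ht ht' (h.trans h'.symm)
  subst this
  rfl

noncomputable instance instFintypeTangent (x : Γ.Point) : Fintype (Γ.Tangent x) :=
  haveI := Γ.finite_E
  haveI := Finite.of_injective _ (Tangent.edge_injective x)
  Fintype.ofFinite _

/-! ## Rational functions and divisors -/

/-- The rational functions on `Γ`: continuous functions that are affine with integral slope on
every segment of an edge whose interior avoids a suitable finite set `W` of points. -/
def Rat (Γ : MetricGraph.{u}) : Set (Γ.Point → ℝ) :=
  {f | Continuous f ∧ ∃ W : Set Γ.Point, W.Finite ∧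
    ∀ (d : Γ.OEdge) (s t : ℝ), 0 ≤ s → s < t → t ≤ Γ.len d.1 →
      (∀ z ∈ Set.Ioo s t, Γ.point d z ∉ W) →
      ∃ m : ℤ, ∀ z ∈ Set.Icc s t, f (Γ.point d z) = f (Γ.point d s) + m * (z - s)}

open Classical in
/-- The outgoing slope at `x` of a rational function `f` along the tangent direction `ν`
(zero, by convention, if `f` is not affine with integral slope near `x` along `ν`). -/
noncomputable def slope (f : Γ.Point → ℝ) {x : Γ.Point} (ν : Γ.Tangent x) : ℤ :=
  if h : ∃ m : ℤ, ∀ᶠ z in 𝓝[>] (0 : ℝ), f (Γ.point ν.edge (ν.pos + z)) = f x + m * z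
  then h.choose else 0

/-- The vector `δ_x(f)` of outgoing slopes of `f` at `x`. -/
noncomputable def slopeVector (f : Γ.Point → ℝ) (x : Γ.Point) : Γ.Tangent x → ℤ :=
  fun ν => slope f ν

/-- The coefficient of `x` in `div(f)`. -/
noncomputable def ord (f : Γ.Point → ℝ) (x : Γ.Point) : ℤ := -∑ ν : Γ.Tangent x, slope f ν

variable (Γ) in
/-- Divisors on `Γ`. -/
abbrev Divisor : Type u := Γ.Point →₀ ℤ

/-- The degree of a divisor. -/
noncomputable def degree (D : Γ.Divisor) : ℤ := D.sum fun _ n => n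

/-- The space `Rat(D)` of rational functions `f` with `D + div(f) ≥ 0`. -/
def RatD (D : Γ.Divisor) : Set (Γ.Point → ℝ) := {f | f ∈ Rat Γ ∧ ∀ x, 0 ≤ D x + ord f x}

/-! ## Slope structures -/

/-- A slope structure of order `r` on the metric graph `Γ`: slopes `s^ν_0 < ⋯ < s^ν_r` for every
point and every tangent direction at it, and a rank function `ρ_x` for every point `x`, which
come from a slope structure on a graph model of `Γ`.

The set `W` in the last field holds the vertices of this model. At the other points the rank
function is standard. If `μ` and `ν` are the tangent directions at the two ends of a segment
(pointing towards each other along an edge of `Γ`) whose interior contains no point of `W`, then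
`s^μ_i + s^ν_{r - i} = 0`; so the slopes depend only on the oriented edge of the model to which
the tangent direction is parallel. As `W` may be enlarged by any finite set of points (with
standard rank functions), the model can be taken to be simple. -/
@[ext]
structure SlopeStructure (Γ : MetricGraph.{u}) (r : ℕ) where
  s : ∀ {x : Γ.Point}, Γ.Tangent x → Fin (r + 1) → ℤ
  strictMono : ∀ {x : Γ.Point} (ν : Γ.Tangent x), StrictMono (s ν)
  ρ : ∀ x : Γ.Point, (Γ.Tangent x → Fin (r + 1)) → ℤ
  isRankFunction : ∀ x, IsRankFunction (ρ x)
  exists_model : ∃ W : Set Γ.Point, W.Finite ∧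
    (∀ x, x ∉ W → ∀ a, ρ x a = standardRank a) ∧
    ∀ {x y : Γ.Point} (μ : Γ.Tangent x) (ν : Γ.Tangent y),
      ν.edge = rev μ.edge → μ.pos < Γ.len μ.edge.1 - ν.pos →
      (∀ z ∈ Set.Ioo μ.pos (Γ.len μ.edge.1 - ν.pos), Γ.point μ.edge z ∉ W) →
      ∀ i : Fin (r + 1), s μ i + s ν (Fin.rev i) = 0

namespace SlopeStructure

variable {r : ℕ} (S : SlopeStructure Γ r)

/-- The set `S^ν` of allowed slopes along `ν`. -/
def slopeSet {x : Γ.Point} (ν : Γ.Tangent x) : Set ℤ := Set.range (S.s ν)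

/-- The vector `s_a` attached to a point `a` of the hypercube at `x`. -/
def vec (x : Γ.Point) (a : Γ.Tangent x → Fin (r + 1)) : Γ.Tangent x → ℤ := fun ν => S.s ν (a ν)

/-- The set `S^x` of the vectors `s_a`, for `a` a jump of `ρ_x`. -/
def vecSet (x : Γ.Point) : Set (Γ.Tangent x → ℤ) := S.vec x '' {a | IsJump (S.ρ x) a}

/-- The space `Rat(S)` of rational functions compatible with the slope structure. -/
def RatS : Set (Γ.Point → ℝ) :=
  {f | f ∈ Rat Γ ∧ (∀ (x : Γ.Point) (ν : Γ.Tangent x), slope f ν ∈ S.slopeSet ν) ∧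
    ∀ x, slopeVector f x ∈ S.vecSet x}

/-- The inequality `ρ_x(δ_x(f)) ≥ n`, where `ρ_x` is transported to `∏_ν S^ν` by `a ↦ s_a`. -/
def RankGE (f : Γ.Point → ℝ) (x : Γ.Point) (n : ℤ) : Prop :=
  ∃ a, slopeVector f x = S.vec x a ∧ n ≤ S.ρ x a

/-- The rank condition on a set `M` of functions, with respect to the pair `(D, S)`. -/
def RankCondition (D : Γ.Divisor) (M : Set (Γ.Point → ℝ)) : Prop :=
  ∀ E : Γ.Divisor, 0 ≤ E → degree E = r →
    ∃ f ∈ M, (∀ x, S.RankGE f x (E x)) ∧ ∀ x, 0 ≤ D x + ord f x - E x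

/-- The space `Rat(D, S)`. -/
def RatDS (D : Γ.Divisor) : Set (Γ.Point → ℝ) := {f | f ∈ S.RatS ∧ ∀ x, 0 ≤ D x + ord f x}

/-- The pair `(D, S)` is a crude linear series. -/
def IsCrudeLinearSeries (D : Γ.Divisor) : Prop := S.RankCondition D (S.RatDS D)

/-- `M` is a linear series associated to `(D, S)`. -/
structure IsLinearSeries (D : Γ.Divisor) (M : Set (Γ.Point → ℝ)) : Prop where
  crude : S.IsCrudeLinearSeries D
  subset : M ⊆ S.RatDS D
  /-- `M` is a sub-semimodule for the operations `min` and addition of real constants. -/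
  min_mem : ∀ f ∈ M, ∀ g ∈ M, (fun x => min (f x) (g x)) ∈ M
  add_const_mem : ∀ f ∈ M, ∀ c : ℝ, (fun x => f x + c) ∈ M
  /-- `M` is closed in `Rat(D)` for the norm of uniform convergence. -/
  closed : ∀ f ∈ RatD D, (∀ ε : ℝ, 0 < ε → ∃ g ∈ M, ∀ x, |f x - g x| ≤ ε) → f ∈ M
  rank : S.RankCondition D M

end SlopeStructure

end MetricGraph

/-! ## Combinatorics of rank functions -/

/-! Part 1 isolates a jump `a` of rank `r - m` at `v` by means of `m` points close to `v`. At an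
interior point of an edge of the model the rank function is standard, so compatible functions have
non-increasing slopes along such an edge, and rank at least 1 forces the slope to drop strictly.
`exists_probe` produces `m` such positions so that a function of `M` whose slopes drop at all of
them, and whose jump at `v` has rank at least `ρ a`, must have slope vector `s_a`. The rank
property, applied to `ρ a` times `v` plus these `m` points, then provides the required function.

The positions are found by induction on `m`. Choose a jump `c < a` of rank `ρ a + 1`, positions
isolating `c`, and a direction `ν` with `c ν < a ν`. If no further position `t` on `ν` were
suitable, there would be counterexamples with jumps `b t ≠ a` for every `t`; let `t` tend to `v`.
The limit lies in `M` by compactness, keeps the other drops, and its slopes at `v` are at most those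
of the counterexamples, strictly so along `ν` because the drop has moved into `v`. Its jump is thus
strictly below `b t`, has larger rank, and equals `c`. Then `c + e_ν` lies below both `a` and `b t`,
and supermodularity forces `b t = a`.

For part 2, part 1 identifies `S^x` with the set of slope vectors at `x` of elements of `M`.
Projecting it to `ν` gives `S^ν`, and a rank function is determined by its jumps
(`eq_of_isJump_iff`). -/

namespace IsRankFunction

variable {ι : Type*} {r : ℕ} {ρ ρ' : (ι → Fin (r + 1)) → ℤ}

/-- Supermodularity for `a` and the axis point `(b i) e_i`: their join is `b` and their meet is `(a
i) e_i`, whose rank is known. -/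
theorem sub_one_le (hρ : IsRankFunction ρ) {a b : ι → Fin (r + 1)} {i : ι}
    (hi : (b i : ℕ) = a i + 1) (hj : ∀ j, j ≠ i → b j = a j) : ρ a - 1 ≤ ρ b := by
  classical
  let w : ι → Fin (r + 1) := Function.update 0 i (b i)
  have hab : a i ≤ b i := by rw [Fin.le_def]; omega
  have hsup : a ⊔ w = b := by
    funext j
    by_cases h : j = i
    · subst h; simp [w, hab]
    · simp [w, h, hj j h]
  have hw : ρ w = r - (b i : ℕ) := by
    rw [hρ.axis i w fun j h => by simp [w, h]]
    simp [w]
  have hinf : ρ (a ⊓ w) = r - (a i : ℕ) := by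
    rw [hρ.axis i _ fun j h => by simp [w, h]]
    simp [w, hab]
  have := hρ.supermodular a w
  rw [hsup, hw, hinf, hi] at this
  push_cast at this
  linarith

theorem exists_succ_le {a b : ι → Fin (r + 1)} {i : ι} (h : a i < b i) :
    ∃ c : ι → Fin (r + 1), (c i : ℕ) = a i + 1 ∧ (∀ j, j ≠ i → c j = a j) ∧ a < c ∧
      (a ≤ b → c ≤ b) := by
  classical
  have hlt : (a i : ℕ) + 1 < r + 1 := by
    have := (b i).isLt
    rw [Fin.lt_def] at h
    omega
  have hi : a i < ⟨a i + 1, hlt⟩ := by rw [Fin.lt_def]; exact Nat.lt_succ_self _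
  refine ⟨Function.update a i ⟨a i + 1, hlt⟩, by simp, fun j hj => by simp [hj], ?_, ?_⟩
  · rw [lt_update_self_iff]
    exact hi
  · intro hab j
    by_cases hj : j = i
    · subst hj
      rw [Function.update_self, Fin.le_def]
      exact h
    · rw [Function.update_of_ne hj]
      exact hab j

theorem _root_.IsJump.rank_lt (hρ : IsRankFunction ρ) {a b : ι → Fin (r + 1)} (ha : IsJump ρ a)
    (hab : a < b) : ρ b < ρ a := by
  obtain ⟨i, hi⟩ := (Pi.lt_def.1 hab).2
  obtain ⟨c, hc, hc', -, hcb⟩ := exists_succ_le hi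
  have h1 := ha.2 i c hc hc'
  have h2 := hρ.antitone c b (hcb hab.le)
  linarith

theorem _root_.IsJump.eq_of_le (hρ : IsRankFunction ρ) {a b : ι → Fin (r + 1)} (ha : IsJump ρ a)
    (hab : a ≤ b) (h : ρ a ≤ ρ b) : b = a := by
  by_contra hne
  exact absurd (ha.rank_lt hρ (lt_of_le_of_ne hab (Ne.symm hne))) (not_lt.2 h)

theorem isJump_of_maximal (hρ : IsRankFunction ρ) {a : ι → Fin (r + 1)} (ha : 0 ≤ ρ a)
    (h : ∀ b, a < b → ρ b < ρ a) : IsJump ρ a := by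
  refine ⟨ha, fun i b hi hj => ?_⟩
  have h1 := hρ.sub_one_le hi hj
  have h2 := h b ?_
  · linarith [Int.add_one_le_iff.2 h2]
  · rw [Pi.lt_def]
    refine ⟨fun j => ?_, i, by rw [Fin.lt_def]; omega⟩
    by_cases h : j = i
    · subst h; rw [Fin.le_def]; omega
    · rw [hj j h]

theorem exists_isJump_ge [Finite ι] (hρ : IsRankFunction ρ) {a : ι → Fin (r + 1)} (ha : 0 ≤ ρ a) :
    ∃ b, a ≤ b ∧ IsJump ρ b ∧ ρ b = ρ a := by
  obtain ⟨b, hab, hb⟩ := (Set.toFinite {b | a ≤ b ∧ ρ a ≤ ρ b}).exists_le_maximal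
    (show a ∈ {b | a ≤ b ∧ ρ a ≤ ρ b} from ⟨le_rfl, le_rfl⟩)
  have hba : ρ b = ρ a := le_antisymm (hρ.antitone _ _ hab) hb.prop.2
  refine ⟨b, hab, hρ.isJump_of_maximal (hba ▸ ha) fun c hc => ?_, hba⟩
  by_contra! h
  exact absurd (hb.le_of_ge ⟨hab.trans hc.le, hba ▸ h⟩ hc.le) hc.not_ge

/-- Take `c` maximal among the points below `a` of rank greater than `ρ a`. A unit step from `c`
that stays below `a` lowers the rank by maximality. A step leaving the box below `a` is compared
with the corresponding step from the jump `a`, through supermodularity. -/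
theorem exists_isJump_lt [Finite ι] (hρ : IsRankFunction ρ) {a : ι → Fin (r + 1)}
    (ha : IsJump ρ a) (h0 : ρ a < ρ 0) : ∃ c, c < a ∧ IsJump ρ c ∧ ρ c = ρ a + 1 := by
  obtain ⟨c, -, hc⟩ := (Set.toFinite {c | c ≤ a ∧ ρ a < ρ c}).exists_le_maximal
    (show (0 : ι → Fin (r + 1)) ∈ {c | c ≤ a ∧ ρ a < ρ c} from ⟨fun i => Fin.zero_le _, h0⟩)
  have hca : c < a := lt_of_le_of_ne hc.prop.1 fun h => by
    have := hc.prop.2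
    rw [h] at this
    exact lt_irrefl _ this
  have hmax : ∀ b, c < b → b ≤ a → ρ b ≤ ρ a := fun b hb hba => by
    by_contra! h
    exact absurd (hc.le_of_ge ⟨hba, h⟩ hb.le) hb.not_ge
  have hρc : ρ c = ρ a + 1 := by
    obtain ⟨i, hi⟩ := (Pi.lt_def.1 hca).2
    obtain ⟨b, hb, hb', hcb, hba⟩ := exists_succ_le hi
    have h1 := hρ.sub_one_le hb hb'
    have h2 := hmax b hcb (hba hca.le)
    have h3 := Int.add_one_le_iff.2 hc.prop.2
    linarith
  refine ⟨c, hca, ⟨by linarith [ha.1], fun i b hi hj => ?_⟩, hρc⟩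
  have h1 := hρ.sub_one_le hi hj
  refine le_antisymm ?_ h1
  have hcb : c < b := by
    rw [Pi.lt_def]
    refine ⟨fun j => ?_, i, by rw [Fin.lt_def]; omega⟩
    by_cases h : j = i
    · subst h; rw [Fin.le_def]; omega
    · rw [hj j h]
  by_cases hba : b ≤ a
  · linarith [hmax b hcb hba]
  · have hai : a i = c i := by
      by_contra hne
      refine hba fun j => ?_
      by_cases h : j = i
      · subst h
        have h2 : c j < a j := lt_of_le_of_ne (hca.le j) (Ne.symm hne)
        rw [Fin.lt_def] at h2
        rw [Fin.le_def]
        omega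
      · rw [hj j h]; exact hca.le j
    have h2 := ha.2 i (a ⊔ b) ?_ ?_
    · have h3 := hρ.supermodular a b
      have h4 : a ⊓ b = c := by
        funext j
        by_cases h : j = i
        · subst h
          simp [hai, hcb.le j]
        · simp [hj j h, hca.le j]
      rw [h4, h2] at h3
      linarith
    · rw [Pi.sup_apply, hai, sup_eq_right.2 (hcb.le i), hi]
    · intro j h
      rw [Pi.sup_apply, hj j h, sup_eq_left.2 (hca.le j)]

/-- Since `ρ (a ⊓ b) ≤ ρ e`, supermodularity leaves `a ⊔ b` with rank at least that of `a` and of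
`b`; nothing strictly above a jump has that much rank. -/
theorem isJump_unique (hρ : IsRankFunction ρ) {a b e : ι → Fin (r + 1)} (ha : IsJump ρ a)
    (hb : IsJump ρ b) (hea : e ≤ a) (heb : e ≤ b) (h1 : ρ e ≤ ρ a) (h2 : ρ e ≤ ρ b) :
    a = b := by
  have h3 := hρ.supermodular a b
  have h4 := hρ.antitone e (a ⊓ b) (le_inf hea heb)
  rw [← ha.eq_of_le hρ le_sup_left (by linarith : ρ a ≤ ρ (a ⊔ b))]
  exact hb.eq_of_le hρ le_sup_right (by linarith)

theorem rank_le_sub (hρ : IsRankFunction ρ) (a : ι → Fin (r + 1)) (i : ι) :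
    ρ a ≤ r - (a i : ℕ) := by
  classical
  let u : ι → Fin (r + 1) := Function.update 0 i (a i)
  have hu : ρ u = r - (a i : ℕ) := by
    rw [hρ.axis i u fun j h => by simp [u, h]]
    simp [u]
  rw [← hu]
  refine hρ.antitone _ _ fun j => ?_
  by_cases hj : j = i
  · subst hj; simp [u]
  · simp [u, hj]

theorem eq_zero_of_rank_eq (hρ : IsRankFunction ρ) {a : ι → Fin (r + 1)} (h : (r : ℤ) ≤ ρ a) :
    a = 0 := by
  funext i
  have h1 := hρ.rank_le_sub a i
  rw [Pi.zero_apply, Fin.ext_iff, Fin.val_zero]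
  omega

theorem rank_zero [Nonempty ι] (hρ : IsRankFunction ρ) : ρ 0 = r := by
  rw [hρ.axis (Classical.arbitrary ι) 0 fun _ _ => rfl]
  simp

/-- Go up from `t e_i` to a jump of the same rank `r - t`; the bound `ρ a ≤ r - a i` prevents the
`i`-th coordinate from growing. This is why every allowed slope occurs in some vector of `S^x`. -/
theorem exists_isJump_apply_eq [Finite ι] (hρ : IsRankFunction ρ) (i : ι) (t : Fin (r + 1)) :
    ∃ a, IsJump ρ a ∧ a i = t := by
  classical
  let u : ι → Fin (r + 1) := Function.update 0 i t
  have hu : ρ u = r - (t : ℕ) := by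
    rw [hρ.axis i u fun j h => by simp [u, h]]
    simp [u]
  obtain ⟨a, hua, ha, h⟩ := hρ.exists_isJump_ge (a := u) (by have := t.isLt; omega)
  refine ⟨a, ha, le_antisymm ?_ (by simpa [u] using hua i)⟩
  have h1 := hρ.rank_le_sub a i
  rw [h, hu] at h1
  rw [Fin.le_def]
  omega

/-- A jump of rank below `r` has a jump just beneath it with rank one more. By induction both
functions agree there, and the other function must drop strictly as well; exchanging the roles gives
equality. -/
theorem rank_le_of_isJump_imp [Finite ι] [Nonempty ι] (hρ : IsRankFunction ρ)
    (hρ' : IsRankFunction ρ') (h : ∀ a, IsJump ρ a ↔ IsJump ρ' a) (a : ι → Fin (r + 1)) :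
    IsJump ρ a → ρ a = ρ' a := by
  induction a using WellFoundedLT.induction with
  | ind a ih =>
    intro ha
    have key : ∀ {τ τ' : (ι → Fin (r + 1)) → ℤ}, IsRankFunction τ → IsRankFunction τ' →
        IsJump τ a → (∀ b, IsJump τ b → IsJump τ' b) → (∀ b, b < a → IsJump τ b → τ b = τ' b) →
        τ' a ≤ τ a := by
      intro τ τ' hτ hτ' hj hjj ih
      by_cases h0 : τ a < τ 0
      · obtain ⟨c, hca, hc, hcr⟩ := hτ.exists_isJump_lt hj h0
        have h1 := (hjj c hc).rank_lt hτ' hca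
        rw [← ih c hca hc, hcr] at h1
        omega
      · rw [hτ.rank_zero] at h0
        linarith [hτ'.le_width a]
    exact le_antisymm
      (key hρ' hρ ((h a).1 ha) (fun b => (h b).2) fun b hb hj => (ih b hb ((h b).2 hj)).symm)
      (key hρ hρ' ha (fun b => (h b).1) ih)

/-- A nonnegative rank is attained at a jump above the point, so ranks at jumps determine all ranks.
-/
theorem eq_of_isJump_iff [Finite ι] [Nonempty ι] (hρ : IsRankFunction ρ)
    (hρ' : IsRankFunction ρ') (h : ∀ a, IsJump ρ a ↔ IsJump ρ' a) : ρ = ρ' := by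
  have key : ∀ {τ τ' : (ι → Fin (r + 1)) → ℤ}, IsRankFunction τ → IsRankFunction τ' →
      (∀ a, IsJump τ a ↔ IsJump τ' a) → ∀ a, τ a ≤ τ' a := by
    intro τ τ' hτ hτ' hj a
    by_cases h0 : 0 ≤ τ a
    · obtain ⟨b, hab, hb, hba⟩ := hτ.exists_isJump_ge h0
      rw [← hba, hτ.rank_le_of_isJump_imp hτ' hj b hb]
      exact hτ'.antitone _ _ hab
    · have := hτ'.neg_one_le a
      omega
  funext a
  exact le_antisymm (key hρ hρ' h a) (key hρ' hρ (fun a => (h a).symm) a)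

end IsRankFunction

/-! ## Functions along oriented edges -/

/-- A continuous induction: the points up to which `h` stays below `h a` form a closed set, which
extends to the right. -/
theorem antitoneOn_Ico_of_local {h : ℝ → ℤ} {p q : ℝ}
    (hr : ∀ z ∈ Ico p q, ∃ u > z, ∀ y ∈ Ioo z u, h y ≤ h z)
    (hl : ∀ z ∈ Ioo p q, ∃ u < z, ∀ y ∈ Ioo u z, h z ≤ h y) : AntitoneOn h (Ico p q) := by
  intro a ha b hb hab
  let s : Set ℝ := {z | ∀ y ∈ Icc a z, h y ≤ h a}
  suffices H : Icc a b ⊆ s from H (right_mem_Icc.2 hab) b (right_mem_Icc.2 hab)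
  refine IsClosed.Icc_subset_of_forall_exists_gt ?_ ?_ ?_
  · refine isClosed_of_closure_subset fun z hz => ?_
    have hzab : z ∈ Icc a b := closure_minimal inter_subset_right isClosed_Icc hz
    have hlt : ∀ y ∈ Ico a z, h y ≤ h a := fun y hy => by
      obtain ⟨w, hw, hw'⟩ := mem_closure_iff.1 hz (Ioi y) isOpen_Ioi hy.2
      exact hw'.1 y ⟨hy.1, le_of_lt hw⟩
    refine ⟨fun y hy => ?_, hzab⟩
    rcases hy.2.lt_or_eq with hyz | rfl
    · exact hlt y ⟨hy.1, hyz⟩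
    · rcases hy.1.eq_or_lt with rfl | hay
      · exact le_rfl
      · obtain ⟨u, hu, huy⟩ := hl y ⟨ha.1.trans_lt hay, hzab.2.trans_lt hb.2⟩
        obtain ⟨w, hw1, hw2⟩ := exists_between (max_lt hu hay)
        exact (huy w ⟨(le_max_left _ _).trans_lt hw1, hw2⟩).trans
          (hlt w ⟨(le_max_right _ _).trans hw1.le, hw2⟩)
  · intro y hy
    rw [Icc_self, mem_singleton_iff] at hy
    rw [hy]
  · rintro x ⟨hx, hxab⟩ y hy
    obtain ⟨u, hu, hxu⟩ := hr x ⟨ha.1.trans hxab.1, hxab.2.trans hb.2⟩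
    obtain ⟨w, hw1, hw2⟩ := exists_between (lt_min hu hy)
    refine ⟨w, fun t ht => ?_, hw1, (hw2.trans_le (min_le_right _ _)).le⟩
    rcases le_or_gt t x with htx | htx
    · exact hx t ⟨ht.1, htx⟩
    · exact (hxu t ⟨htx, ht.2.trans_lt (hw2.trans_le (min_le_left _ _))⟩).trans
        (hx x (right_mem_Icc.2 hxab.1))

namespace MetricGraph

variable {Γ : MetricGraph.{u}}

theorem point_rev (d : Γ.OEdge) (z : ℝ) : Γ.point (rev d) (Γ.len d.1 - z) = Γ.point d z := by
  rcases d with ⟨e, _ | _⟩ <;> simp [point, rev]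

theorem rev_fst (d : Γ.OEdge) : (rev d).1 = d.1 := rfl

theorem rev_ne (d : Γ.OEdge) : rev d ≠ d := by
  rcases d with ⟨e, _ | _⟩ <;> simp [rev]

theorem continuous_edgePoint (e : Γ.E) :
    Continuous fun t : Set.Icc (0 : ℝ) (Γ.len e) => Γ.edgePoint e (t : ℝ) :=
  continuous_iff_coinduced_le.2 (le_iSup (fun e : Γ.E => TopologicalSpace.coinduced
    (fun t : Set.Icc (0 : ℝ) (Γ.len e) => Γ.edgePoint e (t : ℝ)) inferInstance) e)

theorem continuousOn_point (d : Γ.OEdge) : ContinuousOn (Γ.point d) (Icc 0 (Γ.len d.1)) := by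
  have h : ContinuousOn (Γ.edgePoint d.1) (Icc 0 (Γ.len d.1)) :=
    continuousOn_iff_continuous_domRestrict.2 (continuous_edgePoint d.1)
  rcases d with ⟨e, _ | _⟩
  · exact h.congr fun z _ => by simp [point]
  · have : ContinuousOn (fun z : ℝ => Γ.len e - z) (Icc 0 (Γ.len e)) := by fun_prop
    refine (h.comp this ?_).congr fun z _ => by simp [point]
    intro z hz
    exact ⟨by linarith [hz.2], by linarith [hz.1]⟩

/-- The tangent direction along the oriented edge `d` at the position `z`. -/
def tangentAt (d : Γ.OEdge) (z : ℝ) (h0 : 0 ≤ z) (h1 : z < Γ.len d.1) :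
    Γ.Tangent (Γ.point d z) := ⟨d, z, h0, h1, rfl⟩

open Classical in
/-- The slope of `f` along the oriented edge `d` at the position `z`. -/
noncomputable def dirSlope (f : Γ.Point → ℝ) (d : Γ.OEdge) (z : ℝ) : ℤ :=
  if h : ∃ m : ℤ, ∀ᶠ y in 𝓝[>] (0 : ℝ), f (Γ.point d (z + y)) = f (Γ.point d z) + m * y
  then h.choose else 0

/-- Replacing the dependent type `Tangent x` by an edge and a position makes slopes at different
points of an edge comparable. -/
theorem slope_eq_dirSlope (f : Γ.Point → ℝ) {x : Γ.Point} (ν : Γ.Tangent x) :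
    slope f ν = dirSlope f ν.edge ν.pos := by
  obtain ⟨d, z, h0, h1, rfl⟩ := ν
  rfl

theorem dirSlope_eq {f : Γ.Point → ℝ} {d : Γ.OEdge} {z q : ℝ} {m : ℤ} (hq : z < q)
    (h : ∀ y ∈ Ioo z q, f (Γ.point d y) = f (Γ.point d z) + m * (y - z)) :
    dirSlope f d z = m := by
  have hm : ∀ᶠ y in 𝓝[>] (0 : ℝ), f (Γ.point d (z + y)) = f (Γ.point d z) + m * y := by
    filter_upwards [Ioo_mem_nhdsGT (sub_pos.2 hq)] with y hy
    rw [h (z + y) ⟨by linarith [hy.1], by linarith [hy.2]⟩]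
    ring
  have hex : ∃ m : ℤ, ∀ᶠ y in 𝓝[>] (0 : ℝ),
      f (Γ.point d (z + y)) = f (Γ.point d z) + m * y := ⟨m, hm⟩
  unfold dirSlope
  rw [dif_pos hex]
  obtain ⟨y, ⟨hy1, hy2⟩, hy⟩ := ((hex.choose_spec.and hm).and self_mem_nhdsWithin).exists
  rw [hy1, add_right_inj] at hy2
  exact_mod_cast mul_right_cancel₀ (ne_of_gt hy) hy2

theorem finite_setOf_point_mem {W : Set Γ.Point} (hW : W.Finite) (d : Γ.OEdge) :
    {z : ℝ | z ∈ Ico 0 (Γ.len d.1) ∧ Γ.point d z ∈ W}.Finite :=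
  Set.Finite.of_finite_image (f := Γ.point d) (hW.subset (by rintro _ ⟨z, hz, rfl⟩; exact hz.2))
    fun s hs t ht h => point_inj hs.1.1 hs.1.2 ht.1.1 ht.1.2 h

theorem exists_free {W : Set Γ.Point} (hW : W.Finite) {d : Γ.OEdge} {z : ℝ} (h0 : 0 ≤ z)
    (h1 : z < Γ.len d.1) :
    ∃ q, z < q ∧ q ≤ Γ.len d.1 ∧ ∀ y ∈ Ioo z q, Γ.point d y ∉ W := by
  have hfin := ((finite_setOf_point_mem hW d).subset (sdiff_subset (s := {z : ℝ |
    z ∈ Ico 0 (Γ.len d.1) ∧ Γ.point d z ∈ W}) (t := {z}))).isClosed.isOpen_compl.mem_nhds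
    (x := z) (by simp)
  obtain ⟨ε, hε, hball⟩ := Metric.mem_nhds_iff.1 hfin
  refine ⟨min (z + ε) (Γ.len d.1), lt_min (by linarith) h1, min_le_right _ _, fun y hy hyW => ?_⟩
  have hy2 := lt_min_iff.1 hy.2
  refine hball (a := y) ?_ ⟨⟨⟨h0.trans hy.1.le, hy2.2⟩, hyW⟩, ne_of_gt hy.1⟩
  rw [Metric.mem_ball, Real.dist_eq, abs_lt]
  constructor <;> linarith [hy.1]

theorem exists_dirSlope {f : Γ.Point → ℝ} (hf : f ∈ Rat Γ) {d : Γ.OEdge} {z : ℝ} (h0 : 0 ≤ z)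
    (h1 : z < Γ.len d.1) :
    ∃ q, z < q ∧ q ≤ Γ.len d.1 ∧
      ∀ y ∈ Icc z q, f (Γ.point d y) = f (Γ.point d z) + dirSlope f d z * (y - z) := by
  obtain ⟨-, W, hW, h⟩ := hf
  obtain ⟨q, hzq, hq, hfree⟩ := exists_free hW h0 h1
  obtain ⟨m, hm⟩ := h d z q h0 hzq hq hfree
  refine ⟨q, hzq, hq, fun y hy => ?_⟩
  rw [dirSlope_eq hzq fun y hy => hm y (Ioo_subset_Icc_self hy)]
  exact hm y hy

theorem exists_dirSlope_left {f : Γ.Point → ℝ} (hf : f ∈ Rat Γ) {d : Γ.OEdge} {z : ℝ}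
    (h0 : 0 < z) (h1 : z ≤ Γ.len d.1) :
    ∃ p, p < z ∧ 0 ≤ p ∧ ∀ y ∈ Ico p z, dirSlope f d y = -dirSlope f (rev d) (Γ.len d.1 - z) := by
  obtain ⟨q, hq, hq', h⟩ := exists_dirSlope hf (d := rev d) (z := Γ.len d.1 - z)
    (by linarith) (by rw [rev_fst]; linarith)
  rw [rev_fst] at hq'
  have h' : ∀ y ∈ Icc (Γ.len d.1 - q) z, f (Γ.point d y) =
      f (Γ.point d z) + dirSlope f (rev d) (Γ.len d.1 - z) * (z - y) := fun y hy => by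
    have := h (Γ.len d.1 - y) ⟨by linarith [hy.2], by linarith [hy.1]⟩
    rw [point_rev, point_rev] at this
    rw [this]; ring
  refine ⟨Γ.len d.1 - q, by linarith, by linarith, fun y hy => dirSlope_eq hy.2 fun w hw => ?_⟩
  rw [h' w ⟨hy.1.trans hw.1.le, hw.2.le⟩, h' y ⟨hy.1, hy.2.le⟩]
  push_cast
  ring

theorem dirSlope_eq_dirSlope_right {f : Γ.Point → ℝ} (hf : f ∈ Rat Γ) {d : Γ.OEdge} {z : ℝ}
    (h0 : 0 ≤ z) (h1 : z < Γ.len d.1) :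
    ∃ q, z < q ∧ q ≤ Γ.len d.1 ∧ ∀ y ∈ Ico z q, dirSlope f d y = dirSlope f d z := by
  obtain ⟨q, hq, hq', h⟩ := exists_dirSlope hf h0 h1
  refine ⟨q, hq, hq', fun y hy => dirSlope_eq hy.2 fun w hw => ?_⟩
  rw [h w ⟨hy.1.trans hw.1.le, hw.2.le⟩, h y ⟨hy.1, hy.2.le⟩]
  ring

theorem continuousOn_comp_point {f : Γ.Point → ℝ} (hf : f ∈ Rat Γ) (d : Γ.OEdge) :
    ContinuousOn (fun z => f (Γ.point d z)) (Icc 0 (Γ.len d.1)) :=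
  hf.1.comp_continuousOn (continuousOn_point d)

theorem hasDerivWithinAt_comp_point {f : Γ.Point → ℝ} (hf : f ∈ Rat Γ) {d : Γ.OEdge} {z : ℝ}
    (h0 : 0 ≤ z) (h1 : z < Γ.len d.1) :
    HasDerivWithinAt (fun z => f (Γ.point d z)) (dirSlope f d z) (Ici z) z := by
  obtain ⟨q, hq, -, h⟩ := exists_dirSlope hf h0 h1
  have h2 : HasDerivWithinAt (fun y => f (Γ.point d z) + dirSlope f d z * (y - z))
      (dirSlope f d z) (Ici z) z := by
    have := (((hasDerivAt_id z).sub_const z).const_mul (dirSlope f d z : ℝ)).const_add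
      (f (Γ.point d z))
    simpa using this.hasDerivWithinAt
  refine h2.congr_of_eventuallyEq ?_ (by simp)
  filter_upwards [Icc_mem_nhdsGE hq] with y hy
  exact h y hy

theorem sub_le_of_dirSlope_le {f : Γ.Point → ℝ} (hf : f ∈ Rat Γ) {d : Γ.OEdge} {s u : ℝ}
    (h0 : 0 ≤ s) (hsu : s ≤ u) (h1 : u ≤ Γ.len d.1) {m : ℤ}
    (h : ∀ z ∈ Ico s u, dirSlope f d z ≤ m) :
    f (Γ.point d u) - f (Γ.point d s) ≤ m * (u - s) := by
  have := image_le_of_deriv_right_le_deriv_boundary (f := fun z => f (Γ.point d z))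
    (f' := fun z => (dirSlope f d z : ℝ)) (B := fun z => f (Γ.point d s) + m * (z - s))
    (B' := fun _ => (m : ℝ))
    ((continuousOn_comp_point hf d).mono (Icc_subset_Icc h0 h1))
    (fun x hx => hasDerivWithinAt_comp_point hf (h0.trans hx.1) (hx.2.trans_le h1))
    (by simp) (by fun_prop)
    (fun x _ => by
      have := (((hasDerivAt_id x).sub_const s).const_mul (m : ℝ)).const_add (f (Γ.point d s))
      simpa using this.hasDerivWithinAt)
    (fun x hx => by exact_mod_cast h x hx) (right_mem_Icc.2 hsu)
  linarith

theorem le_sub_of_le_dirSlope {f : Γ.Point → ℝ} (hf : f ∈ Rat Γ) {d : Γ.OEdge} {s u : ℝ}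
    (h0 : 0 ≤ s) (hsu : s ≤ u) (h1 : u ≤ Γ.len d.1) {m : ℤ}
    (h : ∀ z ∈ Ico s u, m ≤ dirSlope f d z) :
    m * (u - s) ≤ f (Γ.point d u) - f (Γ.point d s) := by
  have := image_le_of_deriv_right_le_deriv_boundary (B := fun z => f (Γ.point d z))
    (B' := fun z => (dirSlope f d z : ℝ)) (f := fun z => f (Γ.point d s) + m * (z - s))
    (f' := fun _ => (m : ℝ)) (by fun_prop)
    (fun x _ => by
      have := (((hasDerivAt_id x).sub_const s).const_mul (m : ℝ)).const_add (f (Γ.point d s))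
      simpa using this.hasDerivWithinAt)
    (by simp) ((continuousOn_comp_point hf d).mono (Icc_subset_Icc h0 h1))
    (fun x hx => hasDerivWithinAt_comp_point hf (h0.trans hx.1) (hx.2.trans_le h1))
    (fun x hx => by exact_mod_cast h x hx) (right_mem_Icc.2 hsu)
  linarith

/-! ### Concavity of compatible functions along the edges of a model -/

namespace SlopeStructure

variable {r : ℕ} (S : SlopeStructure Γ r)

/-- `W` contains the vertices of a model on which `S` is defined. -/
def IsModel (W : Set Γ.Point) : Prop :=
  W.Finite ∧ (∀ x, x ∉ W → ∀ a, S.ρ x a = standardRank a) ∧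
    ∀ {x y : Γ.Point} (μ : Γ.Tangent x) (ν : Γ.Tangent y),
      ν.edge = rev μ.edge → μ.pos < Γ.len μ.edge.1 - ν.pos →
      (∀ z ∈ Set.Ioo μ.pos (Γ.len μ.edge.1 - ν.pos), Γ.point μ.edge z ∉ W) →
      ∀ i : Fin (r + 1), S.s μ i + S.s ν (Fin.rev i) = 0

open Classical in
/-- The slopes of `S` along the oriented edge `d` at the position `z`. -/
noncomputable def sAt (d : Γ.OEdge) (z : ℝ) (i : Fin (r + 1)) : ℤ :=
  if h : 0 ≤ z ∧ z < Γ.len d.1 then S.s (tangentAt d z h.1 h.2) i else 0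

variable {S}

theorem sAt_eq_s {x : Γ.Point} (ν : Γ.Tangent x) : S.sAt ν.edge ν.pos = S.s ν := by
  obtain ⟨d, z, h0, h1, rfl⟩ := ν
  funext i
  exact dif_pos ⟨h0, h1⟩

theorem strictMono_sAt {d : Γ.OEdge} {z : ℝ} (h0 : 0 ≤ z) (h1 : z < Γ.len d.1) :
    StrictMono (S.sAt d z) := by
  have := S.strictMono (tangentAt d z h0 h1)
  rwa [← sAt_eq_s] at this

theorem IsModel.sAt_add {W : Set Γ.Point} (hW : S.IsModel W) {d : Γ.OEdge} {z z' : ℝ}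
    (h0 : 0 ≤ z) (hz : z < z') (h1 : z' ≤ Γ.len d.1) (h : ∀ y ∈ Ioo z z', Γ.point d y ∉ W)
    (i : Fin (r + 1)) : S.sAt d z i + S.sAt (rev d) (Γ.len d.1 - z') (Fin.rev i) = 0 := by
  have := hW.2.2 (tangentAt d z h0 (by linarith))
    (tangentAt (rev d) (Γ.len d.1 - z') (by linarith) (by rw [rev_fst]; linarith)) rfl
    (by simp only [tangentAt]; linarith) (by simpa [tangentAt] using h) i
  rwa [← sAt_eq_s, ← sAt_eq_s] at this

/-- The slopes at `p` and at `z` are both opposite to those of the reversed edge at one point `w`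
beyond `z`. -/
theorem IsModel.sAt_eq {W : Set Γ.Point} (hW : S.IsModel W) {d : Γ.OEdge} {p z q : ℝ}
    (h0 : 0 ≤ p) (hpz : p ≤ z) (hzq : z < q) (h1 : q ≤ Γ.len d.1)
    (h : ∀ y ∈ Ioo p q, Γ.point d y ∉ W) : S.sAt d z = S.sAt d p := by
  funext i
  obtain ⟨w, hw1, hw2⟩ := exists_between hzq
  have e1 := hW.sAt_add (d := d) (h0.trans hpz) hw1 (by linarith)
    (fun y hy => h y ⟨hpz.trans_lt hy.1, hy.2.trans hw2⟩) i
  have e2 := hW.sAt_add (d := d) h0 (hpz.trans_lt hw1) (by linarith)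
    (fun y hy => h y ⟨hy.1, hy.2.trans hw2⟩) i
  linarith

theorem exists_dirSlope_eq {f : Γ.Point → ℝ} (hf : f ∈ S.RatS) {d : Γ.OEdge} {z : ℝ}
    (h0 : 0 ≤ z) (h1 : z < Γ.len d.1) : ∃ i, dirSlope f d z = S.sAt d z i := by
  obtain ⟨i, hi⟩ := hf.2.1 _ (tangentAt d z h0 h1)
  refine ⟨i, ?_⟩
  rw [slope_eq_dirSlope, ← sAt_eq_s] at hi
  exact hi.symm

theorem rankGE_zero {f : Γ.Point → ℝ} (hf : f ∈ S.RatS) (x : Γ.Point) : S.RankGE f x 0 := by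
  obtain ⟨a, ha, hax⟩ := hf.2.2 x
  exact ⟨a, hax.symm, ha.1⟩

/-- Standard rank at least `n` means that the indices of the two directions along the edge add up to
at most `r - n`. Reversing the second one gives the index `i'` of the incoming slope. -/
theorem IsModel.exists_index {W : Set Γ.Point} (hW : S.IsModel W) {f : Γ.Point → ℝ}
    {d : Γ.OEdge} {z : ℝ} (h0 : 0 < z) (h1 : z < Γ.len d.1) (hz : Γ.point d z ∉ W) {n : ℕ}
    (hn : S.RankGE f (Γ.point d z) n) :
    ∃ i i' : Fin (r + 1), (i : ℕ) + n ≤ i' ∧ dirSlope f d z = S.sAt d z i ∧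
      dirSlope f (rev d) (Γ.len d.1 - z) = S.sAt (rev d) (Γ.len d.1 - z) (Fin.rev i') := by
  classical
  obtain ⟨a, ha, hna⟩ := hn
  let t₁ : Γ.Tangent (Γ.point d z) := tangentAt d z h0.le h1
  let t₂ : Γ.Tangent (Γ.point d z) :=
    ⟨rev d, Γ.len d.1 - z, by linarith, by rw [rev_fst]; linarith, point_rev d z⟩
  have hne : t₁ ≠ t₂ := fun h => rev_ne d (congrArg Tangent.edge h).symm
  have hsum : (a t₁ : ℕ) + a t₂ ≤ ∑ i, (a i : ℕ) := by
    rw [← Finset.sum_pair (f := fun i => (a i : ℕ)) hne]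
    exact Finset.sum_le_sum_of_subset (Finset.subset_univ _)
  rw [hW.2.1 _ hz, standardRank] at hna
  have hle : ∑ i, (a i : ℕ) + n ≤ r := by
    split_ifs at hna with h
    · zify; linarith
    · omega
  refine ⟨a t₁, Fin.rev (a t₂), by rw [Fin.val_rev]; omega, ?_, ?_⟩
  · have := congrFun ha t₁
    rw [slopeVector, slope_eq_dirSlope, vec, ← sAt_eq_s] at this
    exact this
  · have := congrFun ha t₂
    rw [slopeVector, slope_eq_dirSlope, vec, ← sAt_eq_s] at this
    rw [Fin.rev_rev]
    exact this

theorem IsModel.exists_index' {W : Set Γ.Point} (hW : S.IsModel W) {f : Γ.Point → ℝ}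
    {d : Γ.OEdge} {p z q : ℝ} (h0 : 0 ≤ p) (hpz : p < z) (hzq : z < q) (h1 : q ≤ Γ.len d.1)
    (hfree : ∀ y ∈ Ioo p q, Γ.point d y ∉ W) {n : ℕ}
    (hn : S.RankGE f (Γ.point d z) n) :
    ∃ i i' : Fin (r + 1), (i : ℕ) + n ≤ i' ∧ dirSlope f d z = S.sAt d p i ∧
      -dirSlope f (rev d) (Γ.len d.1 - z) = S.sAt d p i' := by
  obtain ⟨i, i', hii, h2, h3⟩ := hW.exists_index (h0.trans_lt hpz) (hzq.trans_le h1)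
    (hfree z ⟨hpz, hzq⟩) hn
  refine ⟨i, i', hii, ?_, ?_⟩
  · rw [h2, hW.sAt_eq h0 hpz.le hzq h1 hfree]
  · have := hW.sAt_add (d := d) h0 hpz (hzq.le.trans h1)
      (fun y hy => hfree y ⟨hy.1, hy.2.trans hzq⟩) i'
    rw [h3]
    linarith

theorem IsModel.antitoneOn_dirSlope {W : Set Γ.Point} (hW : S.IsModel W) {f : Γ.Point → ℝ}
    (hf : f ∈ S.RatS) {d : Γ.OEdge} {p q : ℝ} (h0 : 0 ≤ p) (h1 : q ≤ Γ.len d.1)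
    (hfree : ∀ y ∈ Ioo p q, Γ.point d y ∉ W) : AntitoneOn (dirSlope f d) (Ico p q) := by
  refine antitoneOn_Ico_of_local (fun z hz => ?_) fun z hz => ?_
  · obtain ⟨u, hu, -, h⟩ := dirSlope_eq_dirSlope_right hf.1 (d := d) (h0.trans hz.1)
      (hz.2.trans_le h1)
    exact ⟨u, hu, fun y hy => (h y ⟨hy.1.le, hy.2⟩).le⟩
  · obtain ⟨i, i', hii, h2, h3⟩ := hW.exists_index' h0 hz.1 hz.2 h1 hfree (n := 0)
      (rankGE_zero hf _)
    obtain ⟨u, hu, -, h⟩ := exists_dirSlope_left hf.1 (d := d) (h0.trans_lt hz.1)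
      (hz.2.le.trans h1)
    refine ⟨u, hu, fun y hy => ?_⟩
    rw [h y ⟨hy.1.le, hy.2⟩, h2, h3]
    refine (strictMono_sAt h0 (hz.1.trans (hz.2.trans_le h1))).monotone ?_
    rw [Fin.le_def]
    exact hii

end SlopeStructure

end MetricGraph

/-! ## Compactness -/

namespace MetricGraph

variable {Γ : MetricGraph.{u}}

theorem exists_base {W : Set Γ.Point} (hW : W.Finite) {d : Γ.OEdge} {z : ℝ} (h0 : 0 ≤ z)
    (h1 : z < Γ.len d.1) :
    ∃ w ∈ insert 0 {y : ℝ | y ∈ Ico 0 (Γ.len d.1) ∧ Γ.point d y ∈ W}, 0 ≤ w ∧ w ≤ z ∧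
      ∀ y ∈ Ioc w z, Γ.point d y ∉ W := by
  let P : Set ℝ := insert 0 {y : ℝ | y ∈ Ico 0 (Γ.len d.1) ∧ Γ.point d y ∈ W}
  have hP : (P ∩ Iic z).Finite := ((finite_setOf_point_mem hW d).insert 0).inter_of_left _
  obtain ⟨w, hw0, hw⟩ := hP.exists_le_maximal (a := 0) ⟨mem_insert _ _, h0⟩
  exact ⟨w, hw.prop.1, hw0, hw.prop.2, fun y hy hyW => not_le_of_gt hy.1 (hw.le_of_ge
    ⟨mem_insert_of_mem _ ⟨⟨hw0.trans hy.1.le, hy.2.trans_lt h1⟩, hyW⟩, hy.2⟩ hy.1.le)⟩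

theorem exists_eq_vertex_or_point (x : Γ.Point) :
    (∃ v, x = Point.vertex v) ∨ ∃ e, ∃ t ∈ Ioo 0 (Γ.len e), x = Γ.point (e, false) t := by
  rcases x with v | ⟨e, t, ht⟩
  · exact Or.inl ⟨v, rfl⟩
  · exact Or.inr ⟨e, t, ht, by simp [point, edgePoint, ht]⟩

theorem point_zero (e : Γ.E) : Γ.point (e, false) 0 = Point.vertex (Γ.src e) := by
  simp [point, edgePoint]

theorem point_len (e : Γ.E) : Γ.point (e, false) (Γ.len e) = Point.vertex (Γ.tgt e) := by
  simp [point, edgePoint, Γ.len_pos e]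

namespace SlopeStructure

variable {r : ℕ} {S : SlopeStructure Γ r}

variable (S) in
/-- The slopes of `S` along the oriented edge `d`. -/
def slopesAlong (d : Γ.OEdge) : Set ℤ :=
  {m | ∃ z ∈ Ico 0 (Γ.len d.1), ∃ i, S.sAt d z i = m}

theorem finite_slopesAlong (d : Γ.OEdge) : (S.slopesAlong d).Finite := by
  obtain ⟨W, hW⟩ : ∃ W, S.IsModel W := S.exists_model
  refine (((finite_setOf_point_mem hW.1 d).insert 0).biUnion fun w _ =>
    Set.finite_range (S.sAt d w)).subset ?_
  rintro _ ⟨z, hz, i, rfl⟩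
  obtain ⟨w, hwP, hw0, hwz, hfree⟩ := exists_base hW.1 hz.1 hz.2
  obtain ⟨q, hzq, hq, hfree'⟩ := exists_free hW.1 hz.1 hz.2
  refine mem_biUnion hwP ⟨i, ?_⟩
  rw [hW.sAt_eq hw0 hwz hzq hq]
  intro y hy
  rcases le_or_gt y z with h | h
  · exact hfree y ⟨hy.1, h⟩
  · exact hfree' y ⟨h, hy.2⟩

theorem dirSlope_mem_slopesAlong {f : Γ.Point → ℝ} (hf : f ∈ S.RatS) {d : Γ.OEdge} {z : ℝ}
    (h0 : 0 ≤ z) (h1 : z < Γ.len d.1) : dirSlope f d z ∈ S.slopesAlong d := by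
  obtain ⟨i, hi⟩ := exists_dirSlope_eq hf h0 h1
  exact ⟨z, ⟨h0, h1⟩, i, hi.symm⟩

variable (S) in
theorem exists_lipschitz (d : Γ.OEdge) :
    ∃ K : ℝ, 0 ≤ K ∧ ∀ f ∈ S.RatS, ∀ s ∈ Icc 0 (Γ.len d.1), ∀ u ∈ Icc 0 (Γ.len d.1),
      |f (Γ.point d u) - f (Γ.point d s)| ≤ K * |u - s| := by
  obtain ⟨B, hB⟩ := (finite_slopesAlong (S := S) d).bddAbove
  obtain ⟨A, hA⟩ := (finite_slopesAlong (S := S) d).bddBelow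
  let K : ℤ := max |A| |B|
  have hK : ∀ f ∈ S.RatS, ∀ z ∈ Ico 0 (Γ.len d.1), -K ≤ dirSlope f d z ∧ dirSlope f d z ≤ K := by
    intro f hf z hz
    have h := dirSlope_mem_slopesAlong hf (d := d) hz.1 hz.2
    constructor
    · linarith [hA h, neg_abs_le A, le_max_left |A| |B|]
    · exact (hB h).trans ((le_abs_self B).trans (le_max_right _ _))
  have key : ∀ f ∈ S.RatS, ∀ s ∈ Icc 0 (Γ.len d.1), ∀ u ∈ Icc 0 (Γ.len d.1), s ≤ u →
      |f (Γ.point d u) - f (Γ.point d s)| ≤ K * |u - s| := by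
    intro f hf s hs u hu hsu
    rw [abs_of_nonneg (sub_nonneg.2 hsu), abs_le]
    constructor
    · have := le_sub_of_le_dirSlope hf.1 hs.1 hsu hu.2 (m := -K)
        fun z hz => (hK f hf z ⟨hs.1.trans hz.1, hz.2.trans_le hu.2⟩).1
      push_cast at this
      linarith
    · exact sub_le_of_dirSlope_le hf.1 hs.1 hsu hu.2
        fun z hz => (hK f hf z ⟨hs.1.trans hz.1, hz.2.trans_le hu.2⟩).2
  refine ⟨K, by exact_mod_cast (abs_nonneg A).trans (le_max_left _ _), fun f hf s hs u hu => ?_⟩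
  rcases le_total s u with h | h
  · exact key f hf s hs u hu h
  · rw [abs_sub_comm, abs_sub_comm u]
    exact key f hf u hu s hs h

variable (S) in
-- Chains the Lipschitz bounds along edges, using connectedness. It makes functions normalized at
-- one point pointwise bounded.
theorem exists_bound (x y : Γ.Point) : ∃ C : ℝ, ∀ f ∈ S.RatS, |f x - f y| ≤ C := by
  have hsymm : ∀ {x y : Γ.Point}, (∃ C : ℝ, ∀ f ∈ S.RatS, |f x - f y| ≤ C) →
      ∃ C : ℝ, ∀ f ∈ S.RatS, |f y - f x| ≤ C := fun ⟨C, hC⟩ =>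
    ⟨C, fun f hf => by rw [abs_sub_comm]; exact hC f hf⟩
  have htrans : ∀ {x y z : Γ.Point}, (∃ C : ℝ, ∀ f ∈ S.RatS, |f x - f y| ≤ C) →
      (∃ C : ℝ, ∀ f ∈ S.RatS, |f y - f z| ≤ C) → ∃ C : ℝ, ∀ f ∈ S.RatS, |f x - f z| ≤ C :=
    fun ⟨C, hC⟩ ⟨C', hC'⟩ =>
      ⟨C + C', fun f hf => (abs_sub_le _ _ _).trans (add_le_add (hC f hf) (hC' f hf))⟩
  have hedge : ∀ (e : Γ.E), ∀ s ∈ Icc 0 (Γ.len e), ∀ u ∈ Icc 0 (Γ.len e),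
      ∃ C : ℝ, ∀ f ∈ S.RatS, |f (Γ.point (e, false) u) - f (Γ.point (e, false) s)| ≤ C := by
    intro e s hs u hu
    obtain ⟨K, -, hK⟩ := S.exists_lipschitz (e, false)
    exact ⟨K * |u - s|, fun f hf => hK f hf s hs u hu⟩
  have hvert : ∀ v w : Γ.V, ∃ C : ℝ, ∀ f ∈ S.RatS,
      |f (Point.vertex v) - f (Point.vertex w)| ≤ C := by
    intro v w
    induction Γ.connected v w with
    | rel v w h =>
      obtain ⟨e, rfl, rfl⟩ := h
      rw [← point_zero, ← point_len]
      exact hedge e _ (right_mem_Icc.2 (Γ.len_pos e).le) _ (left_mem_Icc.2 (Γ.len_pos e).le)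
    | refl v => exact ⟨0, fun f _ => by simp⟩
    | symm v w _ ih => exact hsymm ih
    | trans u v w _ _ ih ih' => exact htrans ih ih'
  have hpoint : ∀ x : Γ.Point, ∃ v : Γ.V, ∃ C : ℝ, ∀ f ∈ S.RatS,
      |f x - f (Point.vertex v)| ≤ C := by
    intro x
    rcases exists_eq_vertex_or_point x with ⟨v, rfl⟩ | ⟨e, t, ht, rfl⟩
    · exact ⟨v, 0, fun f _ => by simp⟩
    · refine ⟨Γ.src e, ?_⟩
      rw [← point_zero]
      exact hedge e _ (left_mem_Icc.2 (Γ.len_pos e).le) _ (Ioo_subset_Icc_self ht)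
  obtain ⟨v, hv⟩ := hpoint x
  obtain ⟨w, hw⟩ := hpoint y
  exact htrans hv (htrans (hvert v w) (hsymm hw))

/-! ### Ultrafilter limits of compatible functions -/

section Limit

variable {A : Type*} {𝒰 : Ultrafilter A} {F : A → Γ.Point → ℝ} {f : Γ.Point → ℝ}

theorem exists_tendsto (hF : ∀ α, F α ∈ S.RatS) {v : Γ.Point} (hv : ∀ α, F α v = 0) :
    ∃ f : Γ.Point → ℝ, ∀ x, Tendsto (fun α => F α x) 𝒰 (𝓝 (f x)) := by
  have : ∀ x, ∃ y, Tendsto (fun α => F α x) 𝒰 (𝓝 y) := by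
    intro x
    obtain ⟨C, hC⟩ := S.exists_bound x v
    obtain ⟨y, -, hy⟩ := (isCompact_Icc (a := -C) (b := C)).ultrafilter_le_nhds'
      (𝒰.map fun α => F α x) (Ultrafilter.mem_map.2 (univ_mem' fun α =>
        abs_le.1 (by simpa [hv α] using hC _ (hF α))))
    exact ⟨y, hy⟩
  choose f hf using this
  exact ⟨f, hf⟩

theorem lipschitz_limit (hF : ∀ α, F α ∈ S.RatS)
    (hf : ∀ x, Tendsto (fun α => F α x) 𝒰 (𝓝 (f x))) {d : Γ.OEdge} {K : ℝ}
    (hK : ∀ f ∈ S.RatS, ∀ s ∈ Icc 0 (Γ.len d.1), ∀ u ∈ Icc 0 (Γ.len d.1),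
      |f (Γ.point d u) - f (Γ.point d s)| ≤ K * |u - s|) :
    ∀ s ∈ Icc 0 (Γ.len d.1), ∀ u ∈ Icc 0 (Γ.len d.1),
      |f (Γ.point d u) - f (Γ.point d s)| ≤ K * |u - s| := fun s hs u hu =>
  le_of_tendsto' ((hf _).sub (hf _)).abs fun α => hK _ (hF α) s hs u hu

theorem continuous_limit (hF : ∀ α, F α ∈ S.RatS)
    (hf : ∀ x, Tendsto (fun α => F α x) 𝒰 (𝓝 (f x))) : Continuous f := by
  refine continuous_iSup_dom.2 fun e => continuous_coinduced_dom.2 ?_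
  obtain ⟨K, hK0, hK⟩ := S.exists_lipschitz (e, false)
  have hL := lipschitz_limit hF hf hK
  refine (LipschitzWith.of_dist_le_mul (K := ⟨K, hK0⟩) fun s u => ?_).continuous
  exact hL u u.2 s s.2

/-- Pointwise convergence becomes uniform because the functions are equi-Lipschitz on finitely many
compact edges. -/
theorem eventually_dist_le (hF : ∀ α, F α ∈ S.RatS)
    (hf : ∀ x, Tendsto (fun α => F α x) 𝒰 (𝓝 (f x))) {ε : ℝ} (hε : 0 < ε) :
    ∀ᶠ α in 𝒰, ∀ x, |f x - F α x| ≤ ε := by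
  have := Γ.finite_E
  have := Γ.finite_V
  have hpt : ∀ x, ∀ ε : ℝ, 0 < ε → ∀ᶠ α in 𝒰, |f x - F α x| < ε := fun x ε hε => by
    filter_upwards [Metric.tendsto_nhds.1 (hf x) ε hε] with α hα
    rwa [Real.dist_eq, abs_sub_comm] at hα
  have hedge : ∀ e : Γ.E, ∀ᶠ α in 𝒰, ∀ t ∈ Icc 0 (Γ.len e),
      |f (Γ.point (e, false) t) - F α (Γ.point (e, false) t)| ≤ ε := by
    intro e
    obtain ⟨K, hK0, hK⟩ := S.exists_lipschitz (e, false)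
    have hL := lipschitz_limit hF hf hK
    refine isCompact_Icc.induction_on (p := fun s => ∀ᶠ α in 𝒰, ∀ t ∈ s,
      |f (Γ.point (e, false) t) - F α (Γ.point (e, false) t)| ≤ ε) (by simp)
      (fun s t hst h => h.mono fun α hα x hx => hα x (hst hx))
      (fun s t hs ht => (hs.and ht).mono fun α hα x hx => hx.elim (hα.1 x) (hα.2 x)) ?_
    intro t ht
    have hδ : 0 < ε / (3 * (K + 1)) := by positivity
    refine ⟨Icc 0 (Γ.len e) ∩ Metric.ball t (ε / (3 * (K + 1))),
      inter_mem_nhdsWithin _ (Metric.ball_mem_nhds t hδ), ?_⟩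
    filter_upwards [hpt (Γ.point (e, false) t) (ε / 3) (by positivity)] with α hα y hy
    have h1 := hL t ht y hy.1
    have h2 := hK _ (hF α) t ht y hy.1
    have h3 : K * |y - t| ≤ ε / 3 := by
      have := hy.2
      rw [Metric.mem_ball, Real.dist_eq] at this
      calc K * |y - t| ≤ (K + 1) * (ε / (3 * (K + 1))) :=
            mul_le_mul (by linarith) this.le (abs_nonneg _) (by linarith)
        _ = ε / 3 := by field_simp
    have h4 := abs_le.1 (h1.trans h3)
    have h5 := abs_le.1 (h2.trans h3)
    have h6 := abs_lt.1 hα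
    rw [abs_le]
    constructor <;> linarith
  filter_upwards [eventually_all.2 hedge,
    eventually_all.2 fun v => hpt (Point.vertex v) ε hε] with α h1 h2 x
  rcases exists_eq_vertex_or_point x with ⟨v, rfl⟩ | ⟨e, t, ht, rfl⟩
  · exact (h2 v).le
  · exact h1 e t (Ioo_subset_Icc_self ht)

theorem exists_eventually_dirSlope_eq (hF : ∀ α, F α ∈ S.RatS) {d : Γ.OEdge} {z : ℝ}
    (hz : z ∈ Ico 0 (Γ.len d.1)) :
    ∃ m ∈ S.slopesAlong d, ∀ᶠ α in 𝒰, dirSlope (F α) d z = m := by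
  refine (Ultrafilter.finite_biUnion_mem_iff (finite_slopesAlong (S := S) d)
    (s := fun m => {α | dirSlope (F α) d z = m})).1 (univ_mem' fun α => ?_)
  exact mem_biUnion (dirSlope_mem_slopesAlong (hF α) hz.1 hz.2) rfl

variable {W : Set Γ.Point} {d : Γ.OEdge} {p q : ℝ}

theorem IsModel.sub_le (hW : S.IsModel W) {f : Γ.Point → ℝ} (hf : f ∈ S.RatS) (h0 : 0 ≤ p)
    (h1 : q ≤ Γ.len d.1) (hfree : ∀ y ∈ Ioo p q, Γ.point d y ∉ W) {z s u : ℝ} (hpz : p ≤ z)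
    (hzs : z ≤ s) (hsu : s ≤ u) (huq : u ≤ q) :
    f (Γ.point d u) - f (Γ.point d s) ≤ dirSlope f d z * (u - s) :=
  sub_le_of_dirSlope_le hf.1 (h0.trans (hpz.trans hzs)) hsu (huq.trans h1) fun _ hy =>
    hW.antitoneOn_dirSlope hf h0 h1 hfree ⟨hpz, (hzs.trans hy.1).trans_lt (hy.2.trans_le huq)⟩
      ⟨hpz.trans (hzs.trans hy.1), hy.2.trans_le huq⟩ (hzs.trans hy.1)

theorem IsModel.le_sub (hW : S.IsModel W) {f : Γ.Point → ℝ} (hf : f ∈ S.RatS) (h0 : 0 ≤ p)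
    (h1 : q ≤ Γ.len d.1) (hfree : ∀ y ∈ Ioo p q, Γ.point d y ∉ W) {z s u : ℝ} (hps : p ≤ s)
    (hsu : s ≤ u) (huz : u ≤ z) (hzq : z < q) :
    dirSlope f d z * (u - s) ≤ f (Γ.point d u) - f (Γ.point d s) :=
  le_sub_of_le_dirSlope hf.1 (h0.trans hps) hsu (huz.trans (hzq.le.trans h1)) fun _ hy =>
    hW.antitoneOn_dirSlope hf h0 h1 hfree ⟨hps.trans hy.1, hy.2.trans_le (huz.trans hzq.le)⟩
      ⟨hps.trans (hsu.trans huz), hzq⟩ (hy.2.le.trans huz)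

/-- On each edge of the model the eventual slope `m d z` is non-increasing in `z` with finitely many
values, so it jumps finitely often; between jumps the concavity bounds squeeze `f` to an affine
function. -/
theorem limit_mem_rat (hF : ∀ α, F α ∈ S.RatS)
    (hf : ∀ x, Tendsto (fun α => F α x) 𝒰 (𝓝 (f x))) : f ∈ Rat Γ := by
  obtain ⟨W, hW⟩ : ∃ W, S.IsModel W := S.exists_model
  have hcont := continuous_limit hF hf
  have := Γ.finite_E
  choose! m hmS hm using fun (d : Γ.OEdge) (z : ℝ) (hz : z ∈ Ico 0 (Γ.len d.1)) =>
    exists_eventually_dirSlope_eq (𝒰 := 𝒰) hF hz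
  let P (d : Γ.OEdge) : Set ℝ := insert 0 {y : ℝ | y ∈ Ico 0 (Γ.len d.1) ∧ Γ.point d y ∈ W}
  -- The position, counted from the base `w`, where the eventual slope first falls to `k`. If there
  -- is none, the default value of `sInf` only adds a harmless point.
  let τ (d : Γ.OEdge) (w : ℝ) (k : ℤ) : ℝ := sInf {z | w ≤ z ∧ z < Γ.len d.1 ∧ m d z ≤ k}
  refine ⟨hcont, W ∪ ⋃ d, ⋃ w ∈ P d, (fun k => Γ.point d (τ d w k)) '' S.slopesAlong d,
    hW.1.union (finite_iUnion fun d => ((finite_setOf_point_mem hW.1 d).insert 0).biUnion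
      fun w _ => (finite_slopesAlong d).image _), ?_⟩
  intro d s t h0 hst h1 hfree
  have hanti : ∀ {p : ℝ}, 0 ≤ p → (∀ y ∈ Ioo p t, Γ.point d y ∉ W) →
      AntitoneOn (m d) (Ico p t) := by
    intro p hp hfree y hy y' hy' hyy'
    obtain ⟨α, h2, h3⟩ := ((hm d y ⟨hp.trans hy.1, hy.2.trans_le h1⟩).and
      (hm d y' ⟨hp.trans hy'.1, hy'.2.trans_le h1⟩)).exists
    rw [← h2, ← h3]
    exact hW.antitoneOn_dirSlope (hF α) hp h1 hfree hy hy' hyy'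
  have hfreeW : ∀ y ∈ Ioo s t, Γ.point d y ∉ W := fun y hy h => hfree y hy (Or.inl h)
  have hconst : ∀ y ∈ Ioo s t, ∀ y' ∈ Ioo s t, y ≤ y' → m d y = m d y' := by
    intro y hy y' hy' hyy'
    refine le_antisymm ?_ (hanti h0 hfreeW (Ioo_subset_Ico_self hy) (Ioo_subset_Ico_self hy') hyy')
    by_contra! hlt
    obtain ⟨w, hwP, hw0, hws, hwfree⟩ := exists_base hW.1 h0 (hst.trans_le h1)
    have hanti' : AntitoneOn (m d) (Ico w t) := hanti hw0 fun z hz => by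
      rcases le_or_gt z s with h | h
      · exact hwfree z ⟨hz.1, h⟩
      · exact hfreeW z ⟨h, hz.2⟩
    have hy'len : y' < Γ.len d.1 := hy'.2.trans_le h1
    have hmem : y' ∈ {z | w ≤ z ∧ z < Γ.len d.1 ∧ m d z ≤ m d y'} :=
      ⟨hws.trans hy'.1.le, hy'len, le_rfl⟩
    have hlow : ∀ z ∈ {z | w ≤ z ∧ z < Γ.len d.1 ∧ m d z ≤ m d y'}, y ≤ z := by
      rintro z ⟨hwz, -, hz⟩
      by_contra! hzy
      exact absurd (hanti' ⟨hwz, hzy.trans hy.2⟩ ⟨hws.trans hy.1.le, hy.2⟩ hzy.le)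
        (not_le.2 (hz.trans_lt hlt))
    have h2 : y ≤ τ d w (m d y') := le_csInf ⟨y', hmem⟩ hlow
    have h3 : τ d w (m d y') ≤ y' := csInf_le ⟨y, hlow⟩ hmem
    refine hfree _ ⟨hy.1.trans_le h2, h3.trans_lt hy'.2⟩ (Or.inr ?_)
    exact mem_iUnion_of_mem d (mem_biUnion hwP
      ⟨_, hmS d y' ⟨h0.trans hy'.1.le, hy'len⟩, rfl⟩)
  obtain ⟨y₀, hy₀⟩ := nonempty_Ioo.2 hst
  have hstep : ∀ y ∈ Ioo s t, ∀ y' ∈ Ioo s t, y ≤ y' →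
      f (Γ.point d y') - f (Γ.point d y) = m d y₀ * (y' - y) := by
    have hmc : ∀ y ∈ Ioo s t, m d y = m d y₀ := fun y hy => by
      rcases le_total y y₀ with h | h
      · exact hconst y hy y₀ hy₀ h
      · exact (hconst y₀ hy₀ y hy h).symm
    have hmem : ∀ y ∈ Ioo s t, y ∈ Ico 0 (Γ.len d.1) := fun y hy =>
      ⟨h0.trans hy.1.le, hy.2.trans_le h1⟩
    intro y hy y' hy' hyy'
    refine le_antisymm ?_ ?_
    · refine le_of_tendsto ((hf _).sub (hf _)) ?_
      filter_upwards [hm d y (hmem y hy)] with α hα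
      rw [← hmc y hy, ← hα]
      exact hW.sub_le (hF α) h0 h1 hfreeW hy.1.le le_rfl hyy' hy'.2.le
    · refine ge_of_tendsto ((hf _).sub (hf _)) ?_
      filter_upwards [hm d y' (hmem y' hy')] with α hα
      rw [← hmc y' hy', ← hα]
      exact hW.le_sub (hF α) h0 h1 hfreeW hy.1.le hyy' le_rfl hy'.2
  have heq : EqOn (fun z => f (Γ.point d z))
      (fun z => f (Γ.point d y₀) + m d y₀ * (z - y₀)) (Icc s t) := by
    have : EqOn (fun z => f (Γ.point d z))
        (fun z => f (Γ.point d y₀) + m d y₀ * (z - y₀)) (Ioo s t) := by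
      intro z hz
      rcases le_total z y₀ with h | h
      · have := hstep z hz y₀ hy₀ h
        simp only
        linarith
      · have := hstep y₀ hy₀ z hz h
        simp only
        linarith
    refine this.of_subset_closure ?_ (by fun_prop) Ioo_subset_Icc_self
      (closure_Ioo hst.ne).superset
    exact hcont.comp_continuousOn ((continuousOn_point d).mono (Icc_subset_Icc h0 h1))
  refine ⟨m d y₀, fun z hz => ?_⟩
  have e1 := heq hz
  have e2 := heq (left_mem_Icc.2 hst.le)
  simp only at e1 e2
  linarith

/-- By concavity the initial slope bounds the increments of `F α` from above, and this bound
survives in the limit. -/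
theorem eventually_slope_le (hF : ∀ α, F α ∈ S.RatS)
    (hf : ∀ x, Tendsto (fun α => F α x) 𝒰 (𝓝 (f x))) {x : Γ.Point} (ν : Γ.Tangent x) :
    ∀ᶠ α in 𝒰, slope f ν ≤ slope (F α) ν := by
  obtain ⟨W, hW⟩ : ∃ W, S.IsModel W := S.exists_model
  obtain ⟨d, z, h0, h1, rfl⟩ := ν
  simp only [slope_eq_dirSlope]
  obtain ⟨m, -, hm⟩ := exists_eventually_dirSlope_eq (𝒰 := 𝒰) hF (d := d) ⟨h0, h1⟩
  obtain ⟨q, hzq, hq, hfree⟩ := exists_free hW.1 h0 h1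
  obtain ⟨q', hzq', hq', h⟩ := exists_dirSlope (limit_mem_rat hF hf) h0 h1
  have h2 : f (Γ.point d (min q q')) - f (Γ.point d z) ≤ m * (min q q' - z) := by
    refine le_of_tendsto ((hf _).sub (hf _)) ?_
    filter_upwards [hm] with α hα
    rw [← hα]
    exact hW.sub_le (hF α) h0 hq hfree le_rfl le_rfl (le_min hzq.le hzq'.le) (min_le_left _ _)
  rw [h _ ⟨le_min hzq.le hzq'.le, min_le_right _ _⟩, add_sub_cancel_left] at h2
  have h3 : dirSlope f d z ≤ m := by
    exact_mod_cast le_of_mul_le_mul_right h2 (sub_pos.2 (lt_min hzq hzq'))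
  filter_upwards [hm] with α hα
  rwa [hα]

/-- Slopes can only decrease in the limit, so `ord` can only increase and the limit stays in `RatD
D`; closedness of `M` under uniform limits applies. -/
theorem IsLinearSeries.exists_limit {D : Γ.Divisor} {M : Set (Γ.Point → ℝ)}
    (hM : S.IsLinearSeries D M) (hF : ∀ α, F α ∈ M) {v : Γ.Point} (hv : ∀ α, F α v = 0) :
    ∃ f ∈ M, ∀ x, Tendsto (fun α => F α x) 𝒰 (𝓝 (f x)) := by
  have hFS : ∀ α, F α ∈ S.RatS := fun α => (hM.subset (hF α)).1
  obtain ⟨f, hf⟩ := exists_tendsto (𝒰 := 𝒰) hFS hv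
  refine ⟨f, hM.closed f ⟨limit_mem_rat hFS hf, fun x => ?_⟩ fun ε hε => ?_, hf⟩
  · obtain ⟨α, hα⟩ := (eventually_all.2 fun ν : Γ.Tangent x =>
      eventually_slope_le hFS hf ν).exists
    refine ((hM.subset (hF α)).2 x).trans (add_le_add_right (neg_le_neg ?_) _)
    exact Finset.sum_le_sum fun ν _ => hα ν
  · obtain ⟨α, hα⟩ := (eventually_dist_le hFS hf hε).exists
    exact ⟨F α, hF α, hα⟩

end Limit

end SlopeStructure

end MetricGraph

/-! ## Realization of jumps -/

namespace MetricGraph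

variable {Γ : MetricGraph.{u}}

theorem dirSlope_le {f : Γ.Point → ℝ} (hf : f ∈ Rat Γ) {d : Γ.OEdge} {z q : ℝ} (h0 : 0 ≤ z)
    (h1 : z < Γ.len d.1) (hq : z < q) {m : ℤ}
    (h : ∀ s u, z < s → s ≤ u → u ≤ q → f (Γ.point d u) - f (Γ.point d s) ≤ m * (u - s)) :
    dirSlope f d z ≤ m := by
  obtain ⟨q', hq', -, h'⟩ := exists_dirSlope hf h0 h1
  obtain ⟨s, hs, hs'⟩ := exists_between (lt_min hq hq')
  have h2 := h s _ hs hs'.le (min_le_left _ _)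
  rw [h' _ ⟨hs.le.trans hs'.le, min_le_right _ _⟩, h' s ⟨hs.le, hs'.le.trans (min_le_right _ _)⟩]
    at h2
  have h3 : (dirSlope f d z : ℝ) * (min q q' - s) ≤ m * (min q q' - s) := by linarith
  exact_mod_cast le_of_mul_le_mul_right h3 (sub_pos.2 hs')

theorem le_dirSlope {f : Γ.Point → ℝ} (hf : f ∈ Rat Γ) {d : Γ.OEdge} {z q : ℝ} (h0 : 0 ≤ z)
    (h1 : z < Γ.len d.1) (hq : z < q) {m : ℤ}
    (h : ∀ s u, z ≤ s → s ≤ u → u ≤ q → m * (u - s) ≤ f (Γ.point d u) - f (Γ.point d s)) :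
    m ≤ dirSlope f d z := by
  obtain ⟨q', hq', -, h'⟩ := exists_dirSlope hf h0 h1
  have hlt := lt_min hq hq'
  have h2 := h z _ le_rfl hlt.le (min_le_left _ _)
  rw [h' _ ⟨hlt.le, min_le_right _ _⟩, add_sub_cancel_left] at h2
  exact_mod_cast le_of_mul_le_mul_right h2 (sub_pos.2 hlt)

theorem slopeVector_add_const {f : Γ.Point → ℝ} (hf : f ∈ Rat Γ) (c : ℝ) (x : Γ.Point) :
    slopeVector (fun y => f y + c) x = slopeVector f x := by
  funext ν
  rw [slopeVector, slopeVector, slope_eq_dirSlope, slope_eq_dirSlope]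
  obtain ⟨q, hq, -, h⟩ := exists_dirSlope hf ν.pos_nonneg ν.pos_lt
  refine dirSlope_eq hq fun y hy => ?_
  rw [h y (Ioo_subset_Icc_self hy)]
  ring

theorem degree_add (D E : Γ.Divisor) : degree (D + E) = degree D + degree E :=
  Finsupp.sum_add_index' (fun _ => rfl) fun _ _ _ => rfl

theorem degree_single (x : Γ.Point) (n : ℤ) : degree (Finsupp.single x n) = n :=
  Finsupp.sum_single_index rfl

theorem exists_divisor (v : Γ.Point) {n : ℤ} (hn : 0 ≤ n) (L : List Γ.Point) :
    ∃ E : Γ.Divisor, 0 ≤ E ∧ degree E = n + L.length ∧ n ≤ E v ∧ ∀ x ∈ L, 1 ≤ E x := by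
  classical
  induction L with
  | nil =>
    refine ⟨Finsupp.single v n, Finsupp.single_nonneg.2 hn, by simp [degree_single], by simp, ?_⟩
    simp
  | cons x L ih =>
    obtain ⟨E, hE, hdeg, hv, hL⟩ := ih
    have hx : (0 : Γ.Divisor) ≤ Finsupp.single x 1 := Finsupp.single_nonneg.2 zero_le_one
    refine ⟨E + Finsupp.single x 1, add_nonneg hE hx, ?_, ?_, ?_⟩
    · rw [degree_add, degree_single, hdeg, List.length_cons]
      push_cast
      ring
    · have := hx v
      rw [Finsupp.add_apply]
      exact le_add_of_le_of_nonneg hv this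
    · intro y hy
      rw [Finsupp.add_apply]
      rcases List.mem_cons.1 hy with rfl | hy
      · have := hE y
        rw [Finsupp.single_eq_same]
        exact le_add_of_nonneg_left this
      · exact le_add_of_le_of_nonneg (hL y hy) (hx y)

/-! ### Slope drops and probes near a point -/

namespace SlopeStructure

variable {r : ℕ} {S : SlopeStructure Γ r}

theorem vec_injective (x : Γ.Point) : Function.Injective (S.vec x) := fun a b h => by
  funext ν
  exact (S.strictMono ν).injective (congrFun h ν)

variable (S) in
/-- Along `ν`, the slopes of `f` drop at the position `t`: they are at least `S.s ν k.2` before `t`,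
and at most `S.s ν k.1` from `t` to `q`, with `k.1 < k.2`. -/
structure HasDrop (f : Γ.Point → ℝ) {x : Γ.Point} (ν : Γ.Tangent x) (q t : ℝ)
    (k : Fin (r + 1) × Fin (r + 1)) : Prop where
  lt : k.1 < k.2
  le_sub : ∀ s u, ν.pos ≤ s → s ≤ u → u ≤ t →
    S.s ν k.2 * (u - s) ≤ f (Γ.point ν.edge u) - f (Γ.point ν.edge s)
  sub_le : ∀ s u, t ≤ s → s ≤ u → u ≤ q →
    f (Γ.point ν.edge u) - f (Γ.point ν.edge s) ≤ S.s ν k.1 * (u - s)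

/-- Drops are expressed by increments, which ignore constants and pass to pointwise limits. -/
theorem HasDrop.add_const {f : Γ.Point → ℝ} {x : Γ.Point} {ν : Γ.Tangent x} {q t : ℝ}
    {k : Fin (r + 1) × Fin (r + 1)} (h : S.HasDrop f ν q t k) (c : ℝ) :
    S.HasDrop (fun y => f y + c) ν q t k :=
  ⟨h.lt, fun s u h1 h2 h3 => by simpa using h.le_sub s u h1 h2 h3,
    fun s u h1 h2 h3 => by simpa using h.sub_le s u h1 h2 h3⟩

theorem IsModel.exists_hasDrop {W : Set Γ.Point} (hW : S.IsModel W) {f : Γ.Point → ℝ}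
    (hf : f ∈ S.RatS) {x : Γ.Point} (ν : Γ.Tangent x) {q t : ℝ} (hq : q ≤ Γ.len ν.edge.1)
    (hfree : ∀ y ∈ Ioo ν.pos q, Γ.point ν.edge y ∉ W) (hνt : ν.pos < t) (htq : t < q)
    (h : S.RankGE f (Γ.point ν.edge t) 1) : ∃ k, S.HasDrop f ν q t k := by
  obtain ⟨i, i', hii, h2, h3⟩ := hW.exists_index' ν.pos_nonneg hνt htq hq hfree (n := 1) h
  obtain ⟨p, hpt, -, h4⟩ := exists_dirSlope_left hf.1 (d := ν.edge)
    (ν.pos_nonneg.trans_lt hνt) (htq.le.trans hq)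
  refine ⟨(i, i'), Fin.lt_def.2 hii, fun s u hs hsu hut => ?_, fun s u hts hsu huq => ?_⟩
  · rw [← sAt_eq_s, ← h3]
    refine le_sub_of_le_dirSlope hf.1 (ν.pos_nonneg.trans hs) hsu (hut.trans (htq.le.trans hq))
      fun y hy => ?_
    have hyt : y < t := hy.2.trans_le hut
    have hνy : ν.pos ≤ y := hs.trans hy.1
    rw [← h4 (max y p) ⟨le_max_right _ _, max_lt hyt hpt⟩]
    exact hW.antitoneOn_dirSlope hf ν.pos_nonneg hq hfree ⟨hνy, hyt.trans htq⟩
      ⟨hνy.trans (le_max_left _ _), (max_lt hyt hpt).trans htq⟩ (le_max_left _ _)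
  · rw [← sAt_eq_s, ← h2]
    exact hW.sub_le hf ν.pos_nonneg hq hfree hνt.le hts hsu huq

section Limit

variable {A : Type*} {𝒰 : Ultrafilter A} {F : A → Γ.Point → ℝ} {f : Γ.Point → ℝ}

theorem exists_eventually_hasDrop {x : Γ.Point} {ν : Γ.Tangent x} {q : ℝ} {t : A → ℝ}
    (h : ∀ α, ∃ k, S.HasDrop (F α) ν q (t α) k) : ∃ k, ∀ᶠ α in 𝒰, S.HasDrop (F α) ν q (t α) k := by
  obtain ⟨k, -, hk⟩ := (Ultrafilter.finite_biUnion_mem_iff (f := 𝒰) Set.finite_univ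
    (s := fun k => {α | S.HasDrop (F α) ν q (t α) k})).1
    (univ_mem' fun α => (h α).elim fun k hk => mem_biUnion (mem_univ k) hk)
  exact ⟨k, hk⟩

theorem hasDrop_limit (hf : ∀ x, Tendsto (fun α => F α x) 𝒰 (𝓝 (f x))) {x : Γ.Point}
    {ν : Γ.Tangent x} {q t : ℝ} (h : ∀ α, ∃ k, S.HasDrop (F α) ν q t k) :
    ∃ k, S.HasDrop f ν q t k := by
  obtain ⟨k, hk⟩ := exists_eventually_hasDrop (𝒰 := 𝒰) (t := fun _ => t) h
  refine ⟨k, hk.exists.elim fun _ h => h.lt, fun s u h1 h2 h3 => ?_, fun s u h1 h2 h3 => ?_⟩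
  · exact ge_of_tendsto ((hf _).sub (hf _)) (hk.mono fun α hα => hα.le_sub s u h1 h2 h3)
  · exact le_of_tendsto ((hf _).sub (hf _)) (hk.mono fun α hα => hα.sub_le s u h1 h2 h3)

/-- As the drop reaches `x`, the limit only sees the slopes after it, at most `S.s ν k.1`, whereas
each `F α` still starts with slope at least `S.s ν k.2`. -/
theorem exists_slope_lt (hF : ∀ α, F α ∈ Rat Γ) (hf : f ∈ Rat Γ)
    (hlim : ∀ x, Tendsto (fun α => F α x) 𝒰 (𝓝 (f x))) {x : Γ.Point} {ν : Γ.Tangent x} {q : ℝ}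
    (hq : ν.pos < q) {t : A → ℝ} (ht : ∀ α, ν.pos < t α) (htν : Tendsto t 𝒰 (𝓝 ν.pos))
    (h : ∀ α, ∃ k, S.HasDrop (F α) ν q (t α) k) :
    ∀ᶠ α in 𝒰, slope f ν < slope (F α) ν := by
  obtain ⟨k, hk⟩ := exists_eventually_hasDrop (𝒰 := 𝒰) h
  have h1 : slope f ν ≤ S.s ν k.1 := by
    rw [slope_eq_dirSlope]
    refine dirSlope_le hf ν.pos_nonneg ν.pos_lt hq fun s u hs hsu huq => ?_
    refine le_of_tendsto ((hlim _).sub (hlim _)) ?_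
    filter_upwards [hk, htν.eventually_lt_const hs] with α hα hts
    exact hα.sub_le s u hts.le hsu huq
  filter_upwards [hk] with α hα
  refine h1.trans_lt ((S.strictMono ν hα.lt).trans_le ?_)
  rw [slope_eq_dirSlope]
  exact le_dirSlope (hF α) ν.pos_nonneg ν.pos_lt (ht α) hα.le_sub

end Limit

variable {D : Γ.Divisor} {M : Set (Γ.Point → ℝ)}

/-- Each added position lowers by one the rank that can be isolated; at rank `r` the only candidate
is `0`. -/
theorem IsLinearSeries.exists_probe (hM : S.IsLinearSeries D M) {v : Γ.Point}
    [Nonempty (Γ.Tangent v)] {q : Γ.Tangent v → ℝ} (hq : ∀ ν, ν.pos < q ν) (m : ℕ) :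
    ∀ a, IsJump (S.ρ v) a → S.ρ v a + m = r →
      ∃ L : List (Γ.Tangent v × ℝ), L.length = m ∧ (∀ l ∈ L, l.1.pos < l.2 ∧ l.2 < q l.1) ∧
        ∀ f ∈ M, ∀ b, IsJump (S.ρ v) b → slopeVector f v = S.vec v b → S.ρ v a ≤ S.ρ v b →
          (∀ l ∈ L, ∃ k, S.HasDrop f l.1 (q l.1) l.2 k) → b = a := by
  have hρ := S.isRankFunction v
  induction m with
  | zero =>
    intro a _ ha
    refine ⟨[], rfl, by simp, fun f _ b _ _ hab _ => ?_⟩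
    rw [Nat.cast_zero, add_zero] at ha
    rw [hρ.eq_zero_of_rank_eq (by linarith : (r : ℤ) ≤ S.ρ v b), hρ.eq_zero_of_rank_eq ha.ge]
  | succ m ih =>
    intro a ha har
    push_cast at har
    obtain ⟨c, hca, hc, hcr⟩ := hρ.exists_isJump_lt ha (by rw [hρ.rank_zero]; omega)
    obtain ⟨ν, hν⟩ := (Pi.lt_def.1 hca).2
    obtain ⟨L, hLlen, hL, hLM⟩ := ih c hc (by omega)
    by_contra! hcon
    have hbad : ∀ t : Ioo ν.pos (q ν), ∃ f ∈ M, f v = 0 ∧ ∃ b, IsJump (S.ρ v) b ∧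
        slopeVector f v = S.vec v b ∧ S.ρ v a ≤ S.ρ v b ∧
        (∀ l ∈ (ν, (t : ℝ)) :: L, ∃ k, S.HasDrop f l.1 (q l.1) l.2 k) ∧ b ≠ a := by
      intro t
      obtain ⟨f, hf, b, hb, hfb, hab, hdrop, hne⟩ := hcon ((ν, (t : ℝ)) :: L) (by simp [hLlen])
        (List.forall_mem_cons.2 ⟨t.2, hL⟩)
      refine ⟨fun x => f x + -f v, hM.add_const_mem f hf _, by simp, b, hb, ?_, hab,
        fun l hl => ?_, hne⟩
      · rw [slopeVector_add_const (hM.subset hf).1.1, hfb]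
      · obtain ⟨k, hk⟩ := hdrop l hl
        exact ⟨k, hk.add_const _⟩
    choose F hFM hFv b hb hFb hab hdrop hne using hbad
    -- Positions in the open segment accumulate at `ν.pos`, so some ultrafilter on them converges
    -- there.
    have hneBot : NeBot (comap ((↑) : Ioo ν.pos (q ν) → ℝ) (𝓝 ν.pos)) := by
      rw [comap_neBot_iff_frequently, Subtype.range_coe]
      have h2 : ∃ᶠ x in 𝓝[>] ν.pos, x ∈ Ioo ν.pos (q ν) :=
        (show ∀ᶠ x in 𝓝[>] ν.pos, x ∈ Ioo ν.pos (q ν) from Ioo_mem_nhdsGT (hq ν)).frequently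
      exact h2.filter_mono nhdsWithin_le_nhds
    let 𝒰 := Ultrafilter.of (comap ((↑) : Ioo ν.pos (q ν) → ℝ) (𝓝 ν.pos))
    have h𝒰 : Tendsto ((↑) : Ioo ν.pos (q ν) → ℝ) 𝒰 (𝓝 ν.pos) :=
      tendsto_comap.mono_left (Ultrafilter.of_le _)
    obtain ⟨f, hfM, hlim⟩ := hM.exists_limit (𝒰 := 𝒰) hFM hFv
    have hFS : ∀ t, F t ∈ S.RatS := fun t => (hM.subset (hFM t)).1
    have hfS : f ∈ S.RatS := (hM.subset hfM).1
    obtain ⟨c', hc', hfc'⟩ := hfS.2.2 v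
    have hev := exists_slope_lt (fun t => (hFS t).1) hfS.1 hlim (hq ν)
      (fun t => t.2.1) h𝒰 fun t => hdrop t _ List.mem_cons_self
    obtain ⟨t, hlt, hle⟩ := (hev.and (eventually_all.2 fun μ : Γ.Tangent v =>
      eventually_slope_le hFS hlim μ)).exists
    have hs : ∀ μ : Γ.Tangent v, slope f μ = S.s μ (c' μ) := fun μ => (congrFun hfc' μ).symm
    have hs' : ∀ μ : Γ.Tangent v, slope (F t) μ = S.s μ (b t μ) := fun μ => congrFun (hFb t) μ
    have hc'b : c' ≤ b t := fun μ => by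
      have := hle μ
      rw [hs, hs'] at this
      exact (S.strictMono μ).le_iff_le.1 this
    have hc'ν : c' ν < b t ν := by
      rw [hs, hs'] at hlt
      exact (S.strictMono ν).lt_iff_lt.1 hlt
    have hrank := hc'.rank_lt hρ (Pi.lt_def.2 ⟨hc'b, ν, hc'ν⟩)
    have hcc : c' = c := hLM f hfM c' hc' hfc'.symm (by have := hab t; omega) fun l hl =>
      hasDrop_limit hlim fun t => hdrop t l (List.mem_cons_of_mem _ hl)
    subst hcc
    -- `e = c + e_ν` has rank `ρ c - 1 = ρ a` and lies below both `a` and `b t`.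
    obtain ⟨e, he, he', -, hle⟩ := IsRankFunction.exists_succ_le (a := c') (b := a ⊓ b t)
      (lt_min hν hc'ν)
    have hle := hle (le_inf hca.le hc'b)
    have hρe := hc.2 ν e he he'
    exact hne t (hρ.isJump_unique (hb t) ha (hle.trans inf_le_right) (hle.trans inf_le_left)
      (by have := hab t; omega) (by omega))

theorem IsLinearSeries.exists_slopeVector_eq (hM : S.IsLinearSeries D M) {v : Γ.Point}
    {a : Γ.Tangent v → Fin (r + 1)} (ha : IsJump (S.ρ v) a) :
    ∃ f ∈ M, slopeVector f v = S.vec v a := by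
  -- Without tangent directions there is only one slope vector, so any element of `M` will do.
  rcases isEmpty_or_nonempty (Γ.Tangent v) with hemp | hne
  · obtain ⟨f, hf, -⟩ := hM.rank (Finsupp.single v r) (Finsupp.single_nonneg.2 (by simp))
      (degree_single _ _)
    exact ⟨f, hf, Subsingleton.elim _ _⟩
  · obtain ⟨W, hW⟩ : ∃ W, S.IsModel W := S.exists_model
    choose q hq hql hfree using fun ν : Γ.Tangent v => exists_free hW.1 ν.pos_nonneg ν.pos_lt
    have hle := (S.isRankFunction v).le_width a
    obtain ⟨L, hLlen, hL, hLM⟩ := hM.exists_probe hq (r - S.ρ v a).toNat a ha (by omega)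
    -- The degree is `ρ a + (r - ρ a) = r`, exactly what the rank property allows.
    obtain ⟨E, hE, hdeg, hEv, hEL⟩ := exists_divisor v ha.1
      (L.map fun l => Γ.point l.1.edge l.2)
    obtain ⟨f, hf, hfE, -⟩ := hM.rank E hE (by rw [hdeg, List.length_map, hLlen]; omega)
    have hfS := (hM.subset hf).1
    obtain ⟨b, hb, hfb⟩ := hfS.2.2 v
    obtain ⟨b', hfb', hEb'⟩ := hfE v
    obtain rfl : b = b' := vec_injective v (hfb.trans hfb')
    have := hLM f hf b hb hfb' (hEv.trans hEb') fun l hl => by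
      refine hW.exists_hasDrop hfS l.1 (hql l.1) (hfree l.1) (hL l hl).1 (hL l hl).2 ?_
      obtain ⟨a', ha', h⟩ := hfE (Γ.point l.1.edge l.2)
      exact ⟨a', ha', (hEL _ (List.mem_map_of_mem (f := fun l => Γ.point l.1.edge l.2) hl)).trans h⟩
    exact ⟨f, hf, by rw [hfb', this]⟩

/-! ### Recovering the slope structure from `M` -/

theorem IsLinearSeries.vecSet_eq (hM : S.IsLinearSeries D M) (x : Γ.Point) :
    S.vecSet x = (fun f => slopeVector f x) '' M := by
  refine Subset.antisymm ?_ ?_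
  · rintro _ ⟨a, ha, rfl⟩
    exact hM.exists_slopeVector_eq ha
  · rintro _ ⟨f, hf, rfl⟩
    exact (hM.subset hf).1.2.2 x

theorem slopeSet_eq (x : Γ.Point) (ν : Γ.Tangent x) :
    S.slopeSet ν = (fun a => a ν) '' S.vecSet x := by
  refine Subset.antisymm ?_ ?_
  · rintro _ ⟨i, rfl⟩
    obtain ⟨a, ha, rfl⟩ := (S.isRankFunction x).exists_isJump_apply_eq ν i
    exact ⟨_, ⟨a, ha, rfl⟩, rfl⟩
  · rintro _ ⟨_, ⟨a, -, rfl⟩, rfl⟩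
    exact ⟨a ν, rfl⟩

end SlopeStructure

/-- By connectedness, one edge suffices for every point to have a tangent direction. This fixes the
value `r` of each rank function at `0`. -/
theorem nonempty_tangent (e : Γ.E) (x : Γ.Point) : Nonempty (Γ.Tangent x) := by
  have hsrc : ∀ e : Γ.E, Nonempty (Γ.Tangent (Point.vertex (Γ.src e))) := fun e =>
    ⟨⟨(e, false), 0, le_rfl, Γ.len_pos e, point_zero e⟩⟩
  have htgt : ∀ e : Γ.E, Nonempty (Γ.Tangent (Point.vertex (Γ.tgt e))) := fun e =>
    ⟨⟨(e, true), 0, le_rfl, Γ.len_pos e, by simp [point, edgePoint, Γ.len_pos e]⟩⟩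
  rcases exists_eq_vertex_or_point x with ⟨v, rfl⟩ | ⟨e, t, ht, rfl⟩
  · have key : ∀ v w : Γ.V, Nonempty (Γ.Tangent (Point.vertex v)) ↔
        Nonempty (Γ.Tangent (Point.vertex w)) := by
      intro v w
      induction Γ.connected v w with
      | rel v w h =>
        obtain ⟨e, rfl, rfl⟩ := h
        exact iff_of_true (hsrc e) (htgt e)
      | refl v => exact Iff.rfl
      | symm v w _ ih => exact ih.symm
      | trans u v w _ _ ih ih' => exact ih.trans ih'
    exact (key v (Γ.src e)).2 (hsrc e)
  · exact ⟨⟨(e, false), t, ht.1.le, ht.2, rfl⟩⟩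

namespace SlopeStructure

variable {r : ℕ} {S S' : SlopeStructure Γ r}

theorem eq_of_vecSet_eq [Nonempty Γ.E] (h : ∀ x, S'.vecSet x = S.vecSet x) : S' = S := by
  have hs : ∀ {x : Γ.Point} (ν : Γ.Tangent x), S'.s ν = S.s ν := fun {x} ν => by
    refine ((S'.strictMono ν).range_inj (S.strictMono ν)).1 ?_
    have := S.slopeSet_eq x ν
    rw [← h, ← slopeSet_eq] at this
    exact this.symm
  refine SlopeStructure.ext (by funext x ν; exact hs ν) ?_
  funext x
  have := nonempty_tangent (Classical.arbitrary Γ.E) x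
  have hvec : S'.vec x = S.vec x := by
    funext a ν
    exact congrFun (hs ν) _
  refine (S'.isRankFunction x).eq_of_isJump_iff (S.isRankFunction x) fun a => ?_
  have h2 := h x
  rw [vecSet, vecSet, hvec, (vec_injective x).image_injective.eq_iff] at h2
  exact Set.ext_iff.1 h2 a

end SlopeStructure

end MetricGraph

theorem mainTheorem6 (Γ : MetricGraph.{u}) (r : ℕ) (D : Γ.Divisor)
    (S : MetricGraph.SlopeStructure Γ r) (M : Set (Γ.Point → ℝ)) (hM : S.IsLinearSeries D M) :
    (∀ (v : Γ.Point) (a : Γ.Tangent v → Fin (r + 1)), IsJump (S.ρ v) a →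
      ∃ f ∈ M, MetricGraph.slopeVector f v = S.vec v a) ∧
    (∀ (r' : ℕ) (D' : Γ.Divisor) (S' : MetricGraph.SlopeStructure Γ r'),
      S'.IsLinearSeries D' M →
        (∀ (x : Γ.Point) (ν : Γ.Tangent x), S'.slopeSet ν = S.slopeSet ν) ∧
        (∀ x : Γ.Point, S'.vecSet x = S.vecSet x) ∧
        (Nonempty Γ.E →
          (⟨r', S'⟩ : Σ n : ℕ, MetricGraph.SlopeStructure Γ n) = ⟨r, S⟩)) := by
  refine ⟨fun v a ha => hM.exists_slopeVector_eq ha, fun r' D' S' hM' => ?_⟩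
  have hvec : ∀ x : Γ.Point, S'.vecSet x = S.vecSet x := fun x => by
    rw [hM'.vecSet_eq, hM.vecSet_eq]
  have hslope : ∀ (x : Γ.Point) (ν : Γ.Tangent x), S'.slopeSet ν = S.slopeSet ν := fun x ν => by
    rw [MetricGraph.SlopeStructure.slopeSet_eq, MetricGraph.SlopeStructure.slopeSet_eq, hvec]
  refine ⟨hslope, hvec, fun hE => ?_⟩
  obtain ⟨ν⟩ := MetricGraph.nonempty_tangent hE.some (Γ.point (hE.some, false) 0)
  -- The order is read off from the number `r + 1` of allowed slopes along one direction.
  obtain rfl : r' = r := by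
    have h := congrArg Set.ncard (hslope _ ν)
    have card : ∀ {n : ℕ} (T : MetricGraph.SlopeStructure Γ n), (T.slopeSet ν).ncard = n + 1 :=
      fun T => by
        rw [MetricGraph.SlopeStructure.slopeSet, ← Nat.card_coe_set_eq,
          Nat.card_range_of_injective (T.strictMono ν).injective, Nat.card_eq_fintype_card,
          Fintype.card_fin]
    rw [card, card] at h
    omega
  rw [MetricGraph.SlopeStructure.eq_of_vecSet_eq hvec]
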